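/- **Setting.** Let $\mathbf O$ be the octonions with conjugation $x\mapsto\overline x$, inner product $(x|y)$ and standard orthonormal basis $e_0=1,e_1,\dots,e_7$. Let $\mathcal J^1$ be the 27-dimensional real Jordan algebra of the matrices $$h^1(\xi_1,\xi_2,\xi_3;x_1,x_2,x_3)=\begin{pmatrix}\xi_1&\sqrt{-1}\,x_3&\sqrt{-1}\,\overline{x_2}\\ \sqrt{-1}\,\overline{x_3}&\xi_2&x_1\\ \sqrt{-1}\,x_2&\overline{x_1}&\xi_3\end{pmatrix}\qquad(\xi_i\in\mathbb R,\ x_i\in\mathbf O)$$ with product $X\circ Y=\tfrac12(XY+YX)$, put $\mathrm{tr}(X)=\xi_1+\xi_2+\xi_3$ and $(X|Y)=\mathrm{tr}(X\circ Y)$, and let $\mathrm F_{4(-20)}=\{g\in\mathrm{GL}_{\mathbb R}(\mathcal J^1)\mid g(X\circ Y)=gX\circ gY\}$, with Lie algebra $\mathfrak f_{4(-20)}\subset\mathrm{End}_{\mathbb R}(\mathcal J^1)$. Let $E_i$ be the diagonal idempotents, let $F^1_i(x)$ be the element whose only nonzero entry is $x_i=x$, and put $P^-=h^1(-1,1,0;0,0,1)$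 and $Q^+(x)=h^1(0,0,0;x,\overline x,0)$. For $a\in\mathbf O$ and $p\in\mathrm{Im}\,\mathbf O$ define elements of $\mathfrak f_{4(-20)}$ by their values on $h^1(\xi_1,\xi_2,\xi_3;x_1,x_2,x_3)$: $$\begin{aligned} \tilde A_1^1(a)&:\ h^1\bigl(0,\,2(a|x_1),\,-2(a|x_1);\ -(\xi_2-\xi_3)a,\ -\overline{x_3a},\ \overline{ax_2}\bigr),\\ \tilde A_2^1(a)&:\ h^1\bigl(2(a|x_2),\,0,\,-2(a|x_2);\ -\overline{ax_3},\ -(\xi_3-\xi_1)a,\ -\overline{x_1a}\bigr),\\ \tilde A_3^1(a)&:\ h^1\bigl(-2(a|x_3),\,2(a|x_3),\,0;\ \overline{x_2a},\ \overline{ax_1},\ -(\xi_1-\xi_2)a\bigr),\\ \delta(p)&:\ h^1\bigl(0,0,0;\ px_1,\ x_2p,\ -(px_3+x_3p)\bigr), \end{aligned}$$ and put $\mathcal G_1(x)=\tilde A_1^1(x)+\tilde A_2^1(-\overline x)$, $\mathcal G_2(p)=\tilde A_3^1(-p)-\delta(p)$. Let $\sigma$ change the signs of $x_2$ and $x_3$,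 and let $\theta(X)=\sigma X\sigma$ on $\mathfrak f_{4(-20)}$, a Cartan involution. Put $K=\{g\in\mathrm F_{4(-20)}\mid\sigma g\sigma=g\}$, $\mathfrak a=\mathbb R\,\tilde A_3^1(1)$, $A=\exp\mathfrak a$, and let $M$ be the centralizer of $\mathfrak a$ in $K$. Let $\alpha$ be the functional on $\mathfrak a$ with $\alpha(\tilde A_3^1(1))=1$, let $\mathfrak g_{j\alpha}=\{X\in\mathfrak f_{4(-20)}\mid[\tilde A_3^1(1),X]=jX\}$, so that $\mathfrak f_{4(-20)}=\bigoplus_{j=-2}^{2}\mathfrak g_{j\alpha}$, and put $\mathfrak n^+=\mathfrak g_\alpha\oplus\mathfrak g_{2\alpha}$ and $N^+=\exp\mathfrak n^+$. Let $\theta_\epsilon$ be the involution of $\mathfrak f_{4(-20)}$ equal to $-\theta$ on $\mathfrak g_{\pm\alpha}$ and to $\theta$ on $\mathfrak g_0\oplus\mathfrak g_{\pm2\alpha}$, let $\mathfrak k_\epsilon$ be its fixed point set, let $(K_\epsilon)^0$ be the connected Lie subgroup with Lie algebra $\mathfrak k_\epsilon$, and put $K_\epsilon=(K_\epsilon)^0M$.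 **Theorem (explicit $K_\epsilon$-Iwasawa decomposition of $\mathrm F_{4(-20)}$).** The group $K_\epsilon$ is the stabilizer $\mathrm{Spin}^0(8,1)=\{g\in\mathrm F_{4(-20)}\mid gE_2=E_2\}$ of $E_2$, and $$K_\epsilon AN^+=\{g\in\mathrm F_{4(-20)}\mid(gP^-|E_2)\ne0\}=\{g\in\mathrm F_{4(-20)}\mid(gP^-|E_2)>0\}.$$ This set is open and dense in $\mathrm F_{4(-20)}$. For every $g\in K_\epsilon AN^+$ there are unique $k_\epsilon(g)\in K_\epsilon$, $H_\epsilon(g)\in\mathfrak a$ and $n_\epsilon(g)\in N^+$ such that $$g=k_\epsilon(g)\,\exp(H_\epsilon(g))\,n_\epsilon(g),$$ and they are given by $$\begin{aligned} H_\epsilon(g)&=\tfrac12\log\bigl((gP^-|E_2)\bigr)\,\tilde A_3^1(1),\\ n_\epsilon(g)&=\exp\Biggl(\mathcal G_1\biggl(\frac{\tfrac12\sum_{i=0}^7(gQ^+(e_i)|E_2)\,e_i}{(gP^-|E_2)}\biggr)+\mathcal G_2\biggl(\frac{-\tfrac12\sum_{i=1}^7(gF_3^1(e_i)|E_2)\,e_i}{(gP^-|E_2)}\biggr)\Biggr),\\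 k_\epsilon(g)&=g\,n_\epsilon(g)^{-1}\exp(-H_\epsilon(g)). \end{aligned}$$ -/

import Mathlib

open scoped Quaternion Pointwise

set_option linter.unusedSimpArgs false
set_option linter.unusedTactic false
set_option linter.unreachableTactic false

noncomputable section

namespace F4Iwasawa

/-! ### Octonions -/

/-- The 8-dimensional real vector space underlying the octonions `x₀ e₀ + x₁ e₁ + … + x₇ e₇`. The
product of octonions is `omul` below, the componentwise product is never used. -/
abbrev Octonion : Type := Fin 8 → ℝ

/-- The octonion `(a, b)` made of the quaternions `a = x₀ + x₁ i + x₂ j + x₃ k` and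
`b = x₄ + x₅ i + x₆ j + x₇ k`. -/
def ofPair (a b : ℍ[ℝ]) : Octonion :=
  ![a.re, a.imI, a.imJ, a.imK, b.re, b.imI, b.imJ, b.imK]

/-- The first quaternion of an octonion. -/
def fstQ (x : Octonion) : ℍ[ℝ] := ⟨x 0, x 1, x 2, x 3⟩

/-- The second quaternion of an octonion. -/
def sndQ (x : Octonion) : ℍ[ℝ] := ⟨x 4, x 5, x 6, x 7⟩

/-- Octonion multiplication, by Cayley-Dickson doubling of the quaternions:
`(a, b)(c, d) = (a c - d̄ b, d a + b c̄)`. -/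
def omul (x y : Octonion) : Octonion :=
  ofPair (fstQ x * fstQ y - star (sndQ y) * sndQ x) (sndQ y * fstQ x + sndQ x * star (fstQ y))

infixl:70 " ⋆ " => omul

/-- Octonion conjugation `(a, b) ↦ (ā, -b)`. -/
def oconj (x : Octonion) : Octonion := ofPair (star (fstQ x)) (-sndQ x)

/-- The inner product of octonions, for which `e₀, …, e₇` is orthonormal. -/
def oinner (x y : Octonion) : ℝ := ∑ i, x i * y i

/-- The standard basis `e₀ = 1, e₁, …, e₇` of the octonions. -/
def oe (i : Fin 8) : Octonion := Pi.single i 1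

theorem ofPair_add (a b c d : ℍ[ℝ]) : ofPair (a + c) (b + d) = ofPair a b + ofPair c d := by
  simp [ofPair]

theorem ofPair_smul (r : ℝ) (a b : ℍ[ℝ]) : ofPair (r • a) (r • b) = r • ofPair a b := by
  simp [ofPair]

theorem fstQ_add (x y : Octonion) : fstQ (x + y) = fstQ x + fstQ y := by
  ext <;> simp <;> rfl

theorem sndQ_add (x y : Octonion) : sndQ (x + y) = sndQ x + sndQ y := by
  ext <;> simp <;> rfl

theorem fstQ_smul (r : ℝ) (x : Octonion) : fstQ (r • x) = r • fstQ x := by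
  ext <;> simp <;> rfl

theorem sndQ_smul (r : ℝ) (x : Octonion) : sndQ (r • x) = r • sndQ x := by
  ext <;> simp <;> rfl

theorem fstQ_ofPair (a b : ℍ[ℝ]) : fstQ (ofPair a b) = a := rfl

theorem sndQ_ofPair (a b : ℍ[ℝ]) : sndQ (ofPair a b) = b := rfl

theorem ofPair_fstQ_sndQ (x : Octonion) : ofPair (fstQ x) (sndQ x) = x := by
  ext i; fin_cases i <;> rfl

theorem omul_add (x y z : Octonion) : x ⋆ (y + z) = x ⋆ y + x ⋆ z := by
  simp only [omul, fstQ_add, sndQ_add, star_add, ← ofPair_add]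
  congr 1 <;> noncomm_ring

theorem add_omul (x y z : Octonion) : (x + y) ⋆ z = x ⋆ z + y ⋆ z := by
  simp only [omul, fstQ_add, sndQ_add, ← ofPair_add]
  congr 1 <;> noncomm_ring

theorem omul_smul (c : ℝ) (x y : Octonion) : x ⋆ (c • y) = c • (x ⋆ y) := by
  simp only [omul, fstQ_smul, sndQ_smul, ← ofPair_smul]
  congr 1 <;> simp [smul_sub]

theorem smul_omul (c : ℝ) (x y : Octonion) : (c • x) ⋆ y = c • (x ⋆ y) := by
  simp only [omul, fstQ_smul, sndQ_smul, ← ofPair_smul]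
  congr 1 <;> simp [smul_sub]

theorem oconj_add (x y : Octonion) : oconj (x + y) = oconj x + oconj y := by
  simp only [oconj, fstQ_add, sndQ_add, star_add, neg_add, ← ofPair_add]

theorem oconj_smul (c : ℝ) (x : Octonion) : oconj (c • x) = c • oconj x := by
  simp only [oconj, fstQ_smul, sndQ_smul, ← ofPair_smul]
  congr 1 <;> simp

theorem oinner_add (x y z : Octonion) : oinner x (y + z) = oinner x y + oinner x z := by
  simp [oinner, mul_add, Finset.sum_add_distrib]

theorem oinner_smul (c : ℝ) (x y : Octonion) : oinner x (c • y) = c * oinner x y := by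
  simp [oinner, Finset.mul_sum, mul_left_comm]

theorem oconj_omul (x y : Octonion) : oconj (x ⋆ y) = oconj y ⋆ oconj x := by
  simp only [omul, oconj, fstQ_ofPair, sndQ_ofPair]
  congr 1 <;> simp

theorem oconj_oconj (x : Octonion) : oconj (oconj x) = x := by
  simp only [oconj, fstQ_ofPair, sndQ_ofPair, star_star, neg_neg, ofPair_fstQ_sndQ]

theorem fstQ_oe_zero : fstQ (oe 0) = 1 := by
  ext <;> simp [fstQ, oe]

theorem sndQ_oe_zero : sndQ (oe 0) = 0 := by
  ext <;> simp [sndQ, oe]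

theorem oe_zero_omul (x : Octonion) : oe 0 ⋆ x = x := by
  simp [omul, fstQ_oe_zero, sndQ_oe_zero, ofPair_fstQ_sndQ]

theorem omul_oe_zero (x : Octonion) : x ⋆ oe 0 = x := by
  simp [omul, fstQ_oe_zero, sndQ_oe_zero, ofPair_fstQ_sndQ]

theorem omul_oconj_add (x y : Octonion) :
    x ⋆ oconj y + y ⋆ oconj x = (2 * oinner x y) • oe 0 := by
  simp only [omul, oconj, fstQ_ofPair, sndQ_ofPair, ← ofPair_add]
  ext i; fin_cases i <;>
    simp [oinner, oe, ofPair, Fin.sum_univ_eight] <;> simp [fstQ, sndQ] <;> ring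

theorem oconj_omul_add (x y : Octonion) :
    oconj x ⋆ y + oconj y ⋆ x = (2 * oinner x y) • oe 0 := by
  simp only [omul, oconj, fstQ_ofPair, sndQ_ofPair, ← ofPair_add]
  ext i; fin_cases i <;>
    simp [oinner, oe, ofPair, Fin.sum_univ_eight] <;> simp [fstQ, sndQ] <;> ring

/-! ### The exceptional Jordan algebra -/

/-- The 27-dimensional space `𝒥¹` of the elements `h¹(ξ₁, ξ₂, ξ₃; x₁, x₂, x₃)`. The component
`X.1 i` is `ξ_{i+1}` and `X.2 i` is `x_{i+1}`, for `i : Fin 3`. -/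
abbrev J : Type := (Fin 3 → ℝ) × (Fin 3 → Octonion)

/-- `h¹(ξ₁, ξ₂, ξ₃; x₁, x₂, x₃)`. -/
def h1 (ξ₁ ξ₂ ξ₃ : ℝ) (x₁ x₂ x₃ : Octonion) : J := (![ξ₁, ξ₂, ξ₃], ![x₁, x₂, x₃])

theorem h1_add (a b c a' b' c' : ℝ) (x y z x' y' z' : Octonion) :
    h1 (a + a') (b + b') (c + c') (x + x') (y + y') (z + z') =
      h1 a b c x y z + h1 a' b' c' x' y' z' := by
  simp [h1]

theorem h1_smul (r a b c : ℝ) (x y z : Octonion) :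
    h1 (r * a) (r * b) (r * c) (r • x) (r • y) (r • z) = r • h1 a b c x y z := by
  simp [h1]

/-- The Jordan product of `𝒥¹`, in coordinates. It is `(X Y + Y X) / 2` for the matrix product,
see `toMatrix_jordan`. -/
def jordan (X Y : J) : J :=
  h1 (X.1 0 * Y.1 0 - oinner (X.2 1) (Y.2 1) - oinner (X.2 2) (Y.2 2))
    (X.1 1 * Y.1 1 + oinner (X.2 0) (Y.2 0) - oinner (X.2 2) (Y.2 2))
    (X.1 2 * Y.1 2 + oinner (X.2 0) (Y.2 0) - oinner (X.2 1) (Y.2 1))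
    ((1 / 2 : ℝ) • ((X.1 1 + X.1 2) • Y.2 0 + (Y.1 1 + Y.1 2) • X.2 0
      - oconj (X.2 1 ⋆ Y.2 2) - oconj (Y.2 1 ⋆ X.2 2)))
    ((1 / 2 : ℝ) • ((X.1 2 + X.1 0) • Y.2 1 + (Y.1 2 + Y.1 0) • X.2 1
      + oconj (X.2 2 ⋆ Y.2 0) + oconj (Y.2 2 ⋆ X.2 0)))
    ((1 / 2 : ℝ) • ((X.1 0 + X.1 1) • Y.2 2 + (Y.1 0 + Y.1 1) • X.2 2
      + oconj (X.2 0 ⋆ Y.2 1) + oconj (Y.2 0 ⋆ X.2 1)))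

/-- The trace `ξ₁ + ξ₂ + ξ₃`. -/
def tr (X : J) : ℝ := ∑ i, X.1 i

/-- The (indefinite) inner product `(X|Y) = tr (X ∘ Y)`. -/
def ip (X Y : J) : ℝ := tr (jordan X Y)

/-- Complexified octonions `x + √-1 y`, as pairs `(x, y)`. -/
abbrev OctonionC : Type := Octonion × Octonion

/-- Multiplication of complexified octonions. -/
def cmul (z w : OctonionC) : OctonionC :=
  (z.1 ⋆ w.1 - z.2 ⋆ w.2, z.1 ⋆ w.2 + z.2 ⋆ w.1)

/-- The matrix
`((ξ₁, √-1 x₃, √-1 x̄₂), (√-1 x̄₃, ξ₂, x₁), (√-1 x₂, x̄₁, ξ₃))` of `h¹(ξ₁, ξ₂, ξ₃; x₁, x₂, x₃)`. -/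
def toMatrix (X : J) : Matrix (Fin 3) (Fin 3) OctonionC :=
  !![(X.1 0 • oe 0, 0), (0, X.2 2), (0, oconj (X.2 1));
     (0, oconj (X.2 2)), (X.1 1 • oe 0, 0), (X.2 0, 0);
     (0, X.2 1), (oconj (X.2 0), 0), (X.1 2 • oe 0, 0)]

/-- The Jordan product is the symmetrized product of matrices. -/
theorem toMatrix_jordan (X Y : J) (i j : Fin 3) :
    toMatrix (jordan X Y) i j = (1 / 2 : ℝ) •
      (∑ k, cmul (toMatrix X i k) (toMatrix Y k j) +
        ∑ k, cmul (toMatrix Y i k) (toMatrix X k j)) := by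
  have z1 : ∀ x : Octonion, (0 : Octonion) ⋆ x = 0 := fun x => by
    simpa using smul_omul 0 0 x
  have z2 : ∀ x : Octonion, x ⋆ (0 : Octonion) = 0 := fun x => by
    simpa using omul_smul 0 x 0
  have n1 : ∀ x : Octonion, oconj (-x) = -oconj x := fun x => by
    simpa using oconj_smul (-1) x
  have a1 := fun i => omul_oconj_add (X.2 i) (Y.2 i)
  have a2 := fun i => oconj_omul_add (X.2 i) (Y.2 i)
  fin_cases i <;> fin_cases j <;>
  simp only [toMatrix, jordan, h1, cmul, Fin.sum_univ_three] <;>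
  simp [z1, z2, n1, oconj_add, oconj_smul, smul_omul, omul_smul, oconj_omul, oconj_oconj,
    oe_zero_omul, omul_oe_zero, sub_eq_add_neg]
  · linear_combination (norm := module) (1 / 2 : ℝ) • a1 2 + (1 / 2 : ℝ) • a2 1
  · module
  · module
  · module
  · linear_combination (norm := module) (1 / 2 : ℝ) • a2 2 - (1 / 2 : ℝ) • a1 0
  · module
  · module
  · module
  · linear_combination (norm := module) (1 / 2 : ℝ) • a1 1 - (1 / 2 : ℝ) • a2 0

/-! ### The special elements of `𝒥¹` -/

/-- `E₁`. -/
def E1 : J := h1 1 0 0 0 0 0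
/-- `E₂`. -/
def E2 : J := h1 0 1 0 0 0 0
/-- `F₃¹(x)`. -/
def F3 (x : Octonion) : J := h1 0 0 0 0 0 x
/-- `P⁻ = h¹(-1, 1, 0; 0, 0, 1)`. -/
def Pminus : J := h1 (-1) 1 0 0 0 (oe 0)
/-- `Q⁺(x) = h¹(0, 0, 0; x, x̄, 0)`. -/
def Qplus (x : Octonion) : J := h1 0 0 0 x (oconj x) 0

/-! ### The group `F₄₍₋₂₀₎` and its Lie algebra -/

/-- The algebra of (continuous) real-linear endomorphisms of `𝒥¹`, with the operator norm. -/
abbrev EndJ : Type := J →L[ℝ] J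

/-- The group `GL(𝒥¹)`, with its usual topology. -/
abbrev GLJ : Type := EndJˣ

/-- The exponential map `End(𝒥¹) → GL(𝒥¹)`. -/
def expGL (X : EndJ) : GLJ where
  val := NormedSpace.exp X
  inv := NormedSpace.exp (-X)
  val_inv := by
    let : NormedAlgebra ℚ EndJ := NormedAlgebra.restrictScalars ℚ ℝ EndJ
    let := NormedSpace.invertibleExp X
    rw [← NormedSpace.invOf_exp X]
    exact mul_invOf_self _
  inv_val := by
    let : NormedAlgebra ℚ EndJ := NormedAlgebra.restrictScalars ℚ ℝ EndJ
    let := NormedSpace.invertibleExp X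
    rw [← NormedSpace.invOf_exp X]
    exact invOf_mul_self _

/-- `F₄₍₋₂₀₎`: the automorphism group of the Jordan algebra `𝒥¹`. -/
def F4 : Subgroup GLJ where
  carrier := {g | ∀ X Y : J, (g : EndJ) (jordan X Y) = jordan ((g : EndJ) X) ((g : EndJ) Y)}
  one_mem' := fun _ _ => rfl
  mul_mem' := by
    intro a b ha hb X Y
    have h1 := hb X Y
    have h2 := ha ((b : EndJ) X) ((b : EndJ) Y)
    simp only [Units.val_mul, mul_apply_eq_comp]
    rw [h1, h2]
  inv_mem' := by
    intro a ha X Y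
    have key : ∀ Z : J, (a : EndJ) (((a⁻¹ : GLJ) : EndJ) Z) = Z := fun Z => by
      rw [← mul_apply_eq_comp, Units.mul_inv]; rfl
    have key' : ∀ Z : J, ((a⁻¹ : GLJ) : EndJ) ((a : EndJ) Z) = Z := fun Z => by
      rw [← mul_apply_eq_comp, Units.inv_mul]; rfl
    have h1 := ha (((a⁻¹ : GLJ) : EndJ) X) (((a⁻¹ : GLJ) : EndJ) Y)
    rw [key, key] at h1
    rw [← h1, key']

/-- The Lie algebra `𝔣₄₍₋₂₀₎` of the closed linear group `F₄₍₋₂₀₎`. -/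
def f4 : Set EndJ := {X | ∀ t : ℝ, expGL (t • X) ∈ F4}

/-- `Ã₁¹(a)`. -/
def A1 (a : Octonion) : EndJ := LinearMap.toContinuousLinearMap
  { toFun := fun X => h1 0 (2 * oinner a (X.2 0)) (-2 * oinner a (X.2 0))
      (-(X.1 1 - X.1 2) • a) (-oconj (X.2 2 ⋆ a)) (oconj (a ⋆ X.2 1))
    map_add' := by
      intro X Y
      rw [← h1_add]
      congr 1 <;>
      (try simp only [Prod.fst_add, Prod.snd_add, Pi.add_apply, omul_add, add_omul, oconj_add,
        oinner_add]) <;>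
      first | ring1 | module
    map_smul' := by
      intro c X
      rw [RingHom.id_apply, ← h1_smul]
      congr 1 <;>
      (try simp only [Prod.smul_fst, Prod.smul_snd, Pi.smul_apply, omul_smul, smul_omul, oconj_smul,
        oinner_smul, smul_eq_mul]) <;>
      first | ring1 | module }

/-- `Ã₂¹(a)`. -/
def A2 (a : Octonion) : EndJ := LinearMap.toContinuousLinearMap
  { toFun := fun X => h1 (2 * oinner a (X.2 1)) 0 (-2 * oinner a (X.2 1))
      (-oconj (a ⋆ X.2 2)) (-(X.1 2 - X.1 0) • a) (-oconj (X.2 0 ⋆ a))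
    map_add' := by
      intro X Y
      rw [← h1_add]
      congr 1 <;>
      (try simp only [Prod.fst_add, Prod.snd_add, Pi.add_apply, omul_add, add_omul, oconj_add,
        oinner_add]) <;>
      first | ring1 | module
    map_smul' := by
      intro c X
      rw [RingHom.id_apply, ← h1_smul]
      congr 1 <;>
      (try simp only [Prod.smul_fst, Prod.smul_snd, Pi.smul_apply, omul_smul, smul_omul, oconj_smul,
        oinner_smul, smul_eq_mul]) <;>
      first | ring1 | module }

/-- `Ã₃¹(a)`. -/
def A3 (a : Octonion) : EndJ := LinearMap.toContinuousLinearMap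
  { toFun := fun X => h1 (-2 * oinner a (X.2 2)) (2 * oinner a (X.2 2)) 0
      (oconj (X.2 1 ⋆ a)) (oconj (a ⋆ X.2 0)) (-(X.1 0 - X.1 1) • a)
    map_add' := by
      intro X Y
      rw [← h1_add]
      congr 1 <;>
      (try simp only [Prod.fst_add, Prod.snd_add, Pi.add_apply, omul_add, add_omul, oconj_add,
        oinner_add]) <;>
      first | ring1 | module
    map_smul' := by
      intro c X
      rw [RingHom.id_apply, ← h1_smul]
      congr 1 <;>
      (try simp only [Prod.smul_fst, Prod.smul_snd, Pi.smul_apply, omul_smul, smul_omul, oconj_smul,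
        oinner_smul, smul_eq_mul]) <;>
      first | ring1 | module }

/-- `δ(p)`: it acts by `x₁ ↦ p x₁`, `x₂ ↦ x₂ p`, `x₃ ↦ -(p x₃ + x₃ p)` and kills the `Eᵢ`. -/
def delta (p : Octonion) : EndJ := LinearMap.toContinuousLinearMap
  { toFun := fun X => h1 0 0 0 (p ⋆ X.2 0) (X.2 1 ⋆ p) (-(p ⋆ X.2 2 + X.2 2 ⋆ p))
    map_add' := by
      intro X Y
      rw [← h1_add]
      congr 1 <;>
      (try simp only [Prod.fst_add, Prod.snd_add, Pi.add_apply, omul_add, add_omul, oconj_add,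
        oinner_add]) <;>
      first | ring1 | module
    map_smul' := by
      intro c X
      rw [RingHom.id_apply, ← h1_smul]
      congr 1 <;>
      (try simp only [Prod.smul_fst, Prod.smul_snd, Pi.smul_apply, omul_smul, smul_omul, oconj_smul,
        oinner_smul, smul_eq_mul]) <;>
      first | ring1 | module }

/-- `𝒢₁(x) = Ã₁¹(x) + Ã₂¹(-x̄)`. -/
def G1 (x : Octonion) : EndJ := A1 x + A2 (-oconj x)

/-- `𝒢₂(p) = Ã₃¹(-p) - δ(p)`, for `p` imaginary. -/
def G2 (p : Octonion) : EndJ := A3 (-p) - delta p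

/-- `σ = σ₁`: it fixes `E₁, E₂, E₃, F₁¹(x)` and changes the sign of `F₂¹(x)`, `F₃¹(x)`. -/
def sigma : EndJ := LinearMap.toContinuousLinearMap
  { toFun := fun X => h1 (X.1 0) (X.1 1) (X.1 2) (X.2 0) (-X.2 1) (-X.2 2)
    map_add' := by
      intro X Y
      rw [← h1_add]
      congr 1 <;>
      (try simp only [Prod.fst_add, Prod.snd_add, Pi.add_apply, omul_add, add_omul, oconj_add,
        oinner_add]) <;>
      first | ring1 | module
    map_smul' := by
      intro c X
      rw [RingHom.id_apply, ← h1_smul]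
      congr 1 <;>
      (try simp only [Prod.smul_fst, Prod.smul_snd, Pi.smul_apply, omul_smul, smul_omul, oconj_smul,
        oinner_smul, smul_eq_mul]) <;>
      first | ring1 | module }

/-- The Cartan involution `θ X = σ X σ⁻¹ = σ X σ` (note `σ² = 1`). -/
def theta (X : EndJ) : EndJ := sigma * X * sigma

/-- `K`: the elements of `F₄₍₋₂₀₎` fixed by the involution `g ↦ σ g σ`. -/
def K : Set GLJ := {g | g ∈ F4 ∧ sigma * (g : EndJ) * sigma = g}

/-- `𝔞 = ℝ Ã₃¹(1)`. -/
def 𝔞 : Set EndJ := {X | ∃ t : ℝ, X = t • A3 (oe 0)}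

/-- `A = exp 𝔞`. -/
def A : Set GLJ := expGL '' 𝔞

/-- `M`: the centralizer of `𝔞` in `K`. -/
def M : Set GLJ := {k | k ∈ K ∧ (k : EndJ) * A3 (oe 0) * ((k⁻¹ : GLJ) : EndJ) = A3 (oe 0)}

/-- The root space `𝔤_{cα}`, where `α` is the functional on `𝔞` with `α(Ã₃¹(1)) = 1`. -/
def rootSpace (c : ℝ) : Set EndJ := {X | X ∈ f4 ∧ A3 (oe 0) * X - X * A3 (oe 0) = c • X}

/-- `𝔫⁺ = 𝔤_α + 𝔤_{2α}`. -/
def nplus : Set EndJ := rootSpace 1 + rootSpace 2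

/-- `N⁺ = exp 𝔫⁺`. -/
def Nplus : Set GLJ := expGL '' nplus

/-- The signature of roots `ε(±α) = -1`, `ε(±2α) = 1`. It is extended by `ε(0) = 1`. -/
def sgn (j : ℤ) : ℝ := if j = 1 ∨ j = -1 then -1 else 1

/-- The graph of the involution `θ_ε` of `𝔣₄₍₋₂₀₎`: on `𝔤_{jα}`, `j = -2, …, 2`, it is `ε(jα) θ`
(here `𝔤₀ = 𝔞 ⊕ 𝔪`, and `𝔣₄₍₋₂₀₎` is the direct sum of these five spaces). -/
def IsThetaEps (X Y : EndJ) : Prop :=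
  ∃ Z : ℤ → EndJ, (∀ j ∈ Finset.Icc (-2 : ℤ) 2, Z j ∈ rootSpace (j : ℝ)) ∧
    X = ∑ j ∈ Finset.Icc (-2 : ℤ) 2, Z j ∧
    Y = ∑ j ∈ Finset.Icc (-2 : ℤ) 2, sgn j • theta (Z j)

/-- `𝔨_ε`: the fixed points of `θ_ε` in `𝔣₄₍₋₂₀₎`. -/
def keps : Set EndJ := {X | X ∈ f4 ∧ IsThetaEps X X}

/-- `(K_ε)⁰`: the connected Lie subgroup with Lie algebra `𝔨_ε`, that is the group generated by
`exp 𝔨_ε`. -/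
def Keps0 : Subgroup GLJ := Subgroup.closure (expGL '' keps)

/-- `K_ε = (K_ε)⁰ M`. -/
def Keps : Set GLJ := (Keps0 : Set GLJ) * M

end F4Iwasawa

end

open F4Iwasawa

noncomputable section

namespace F4Iwasawa

/-! ### Coordinates -/

/-! Everything is read off from the scalar functions `g ↦ (g X | E₂)`, for `X` running over highest
weight data of `Ã₃¹(1)` acting on `𝒥¹`. The weights are `-2, …, 2`; the weight `2` space is the line
of `P⁻`, the weight `1` space is `{Q⁺(y)}`, and the `F₃¹(q)` with `q` imaginary have weight `0`.
Hence `N⁺` fixes `P⁻` and moves `Q⁺(y)` and `F₃¹(q)` by terms of higher weight, whose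
`P⁻`-coefficients are linear in the parameters `x`, `p` of `exp(𝒢₁(x) + 𝒢₂(p))`, while `A` scales
`P⁻` by `e^{2t}`. Once `K_ε` is known to be the stabilizer of `E₂`, it leaves these functions
unchanged, because automorphisms preserve `(·|·)`. For `g = k a n` the three families of values
therefore give `t`, `x`, `p` explicitly, which proves uniqueness, the formulas and positivity
(`ip_mul_Pminus`, `nepsOct_mul`, `nepsIm_mul`).

Conversely, if `(gP⁻|E₂) ≠ 0`, let the same formulas define `a` and `n`, and put `h = g n⁻¹ a⁻¹`.
Then `Y = h⁻¹E₂` is an idempotent of trace `1`, orthogonal to all `Q⁺(y)` and all imaginary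
`F₃¹(q)`, with `(Y|P⁻) = ±1`. Solving the idempotent equations leaves `Y = E₂` or `Y = E₁`
(`eq_E2_or_eq_E1`), and `E₁` is excluded since the form has different signatures on the Peirce
`½`-spaces of `E₁` and `E₂`. So `h` fixes `E₂`.

That `K_ε` fixes `E₂` follows from parity of weights for `𝔨_ε` (`keps_apply_E2`), and for `M` from a
characterization of `E₁` by `σ`. In the other direction, an automorphism fixing `E₂` is brought by a
boost `exp(t Ã₂¹(u))` to fix `E₁`, then by a rotation `exp(s δ(p))` to fix `F₃¹(1)`; both `σ` and
`Ã₃¹(1)` are built from multiplications by `E₁` and `F₃¹(1)`, so the result lies in `M`.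

The set is open because it is a nonvanishing locus of a continuous function. For density, a vector
`gP⁻` with zero `E₂`-coefficient acquires a nonzero one under a small rotation `exp(t Ã₁¹(1))`. -/

theorem omul_eq (x y : Octonion) : x ⋆ y =
    ![x 0 * y 0 - x 1 * y 1 - x 2 * y 2 - x 3 * y 3 - x 4 * y 4 - x 5 * y 5 - x 6 * y 6 - x 7 * y 7,
      x 0 * y 1 + x 1 * y 0 + x 2 * y 3 - x 3 * y 2 - x 5 * y 4 + x 4 * y 5 + x 7 * y 6 - x 6 * y 7,
      x 0 * y 2 - x 1 * y 3 + x 2 * y 0 + x 3 * y 1 - x 6 * y 4 - x 7 * y 5 + x 4 * y 6 + x 5 * y 7,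
      x 0 * y 3 + x 1 * y 2 - x 2 * y 1 + x 3 * y 0 - x 7 * y 4 + x 6 * y 5 - x 5 * y 6 + x 4 * y 7,
      x 0 * y 4 - x 1 * y 5 - x 2 * y 6 - x 3 * y 7 + x 4 * y 0 + x 5 * y 1 + x 6 * y 2 + x 7 * y 3,
      x 1 * y 4 + x 0 * y 5 + x 3 * y 6 - x 2 * y 7 - x 4 * y 1 + x 5 * y 0 - x 6 * y 3 + x 7 * y 2,
      x 2 * y 4 - x 3 * y 5 + x 0 * y 6 + x 1 * y 7 - x 4 * y 2 + x 5 * y 3 + x 6 * y 0 - x 7 * y 1,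
      x 3 * y 4 + x 2 * y 5 - x 1 * y 6 + x 0 * y 7 - x 4 * y 3 - x 5 * y 2 + x 6 * y 1 + x 7 * y 0] := by
  ext i; fin_cases i <;> simp [omul, ofPair] <;> simp [fstQ, sndQ] <;> ring

theorem oconj_eq (x : Octonion) : oconj x = ![x 0, -x 1, -x 2, -x 3, -x 4, -x 5, -x 6, -x 7] := by
  ext i; fin_cases i <;> simp [oconj, ofPair] <;> simp [fstQ, sndQ]

theorem oinner_eq (x y : Octonion) : oinner x y =
    x 0 * y 0 + x 1 * y 1 + x 2 * y 2 + x 3 * y 3 + x 4 * y 4 + x 5 * y 5 + x 6 * y 6 + x 7 * y 7 :=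
  Fin.sum_univ_eight _

theorem oinner_comm (x y : Octonion) : oinner x y = oinner y x := by
  simp only [oinner_eq]; ring

theorem omul_zero (x : Octonion) : x ⋆ 0 = 0 := by simpa using omul_smul 0 x 0

theorem zero_omul (x : Octonion) : 0 ⋆ x = 0 := by simpa using smul_omul 0 0 x

theorem oconj_zero : oconj 0 = 0 := by simpa using oconj_smul 0 0

theorem omul_neg (x y : Octonion) : x ⋆ (-y) = -(x ⋆ y) := by simpa using omul_smul (-1) x y

theorem neg_omul (x y : Octonion) : (-x) ⋆ y = -(x ⋆ y) := by simpa using smul_omul (-1) x y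

theorem oconj_neg (x : Octonion) : oconj (-x) = -oconj x := by simpa using oconj_smul (-1) x

theorem oinner_neg (x y : Octonion) : oinner x (-y) = -oinner x y := by
  simpa using oinner_smul (-1) x y

theorem neg_oinner (x y : Octonion) : oinner (-x) y = -oinner x y := by
  rw [oinner_comm, oinner_neg, oinner_comm]

theorem oinner_zero (x : Octonion) : oinner x 0 = 0 := by simp [oinner]

theorem zero_oinner (x : Octonion) : oinner 0 x = 0 := by simp [oinner]

theorem add_oinner (x y z : Octonion) : oinner (x + y) z = oinner x z + oinner y z := by
  simp only [oinner_eq, Pi.add_apply]; ring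

theorem smul_oinner (c : ℝ) (x y : Octonion) : oinner (c • x) y = c * oinner x y := by
  simp only [oinner_eq, Pi.smul_apply, smul_eq_mul]; ring

theorem oinner_self_nonneg (x : Octonion) : 0 ≤ oinner x x := by
  exact Finset.sum_nonneg fun i _ => mul_self_nonneg _

theorem oinner_self_eq_zero {x : Octonion} (h : oinner x x = 0) : x = 0 := by
  rw [oinner, Finset.sum_eq_zero_iff_of_nonneg fun i _ => mul_self_nonneg _] at h
  ext i
  simpa using h i (Finset.mem_univ i)

theorem J.ext' {X Y : J} (h1 : X.1 0 = Y.1 0) (h2 : X.1 1 = Y.1 1) (h3 : X.1 2 = Y.1 2)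
    (h4 : X.2 0 = Y.2 0) (h5 : X.2 1 = Y.2 1) (h6 : X.2 2 = Y.2 2) : X = Y := by
  refine Prod.ext (funext fun i => ?_) (funext fun i => ?_) <;> fin_cases i <;> assumption

theorem h1_fst_zero (a b c : ℝ) (x y z : Octonion) : (h1 a b c x y z).1 0 = a := rfl
theorem h1_fst_one (a b c : ℝ) (x y z : Octonion) : (h1 a b c x y z).1 1 = b := rfl
theorem h1_fst_two (a b c : ℝ) (x y z : Octonion) : (h1 a b c x y z).1 2 = c := rfl
theorem h1_snd_zero (a b c : ℝ) (x y z : Octonion) : (h1 a b c x y z).2 0 = x := rfl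
theorem h1_snd_one (a b c : ℝ) (x y z : Octonion) : (h1 a b c x y z).2 1 = y := rfl
theorem h1_snd_two (a b c : ℝ) (x y z : Octonion) : (h1 a b c x y z).2 2 = z := rfl

theorem A1_apply (a : Octonion) (X : J) : A1 a X =
    h1 0 (2 * oinner a (X.2 0)) (-2 * oinner a (X.2 0))
      (-(X.1 1 - X.1 2) • a) (-oconj (X.2 2 ⋆ a)) (oconj (a ⋆ X.2 1)) := rfl

theorem A2_apply (a : Octonion) (X : J) : A2 a X =
    h1 (2 * oinner a (X.2 1)) 0 (-2 * oinner a (X.2 1))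
      (-oconj (a ⋆ X.2 2)) (-(X.1 2 - X.1 0) • a) (-oconj (X.2 0 ⋆ a)) := rfl

theorem A3_apply (a : Octonion) (X : J) : A3 a X =
    h1 (-2 * oinner a (X.2 2)) (2 * oinner a (X.2 2)) 0
      (oconj (X.2 1 ⋆ a)) (oconj (a ⋆ X.2 0)) (-(X.1 0 - X.1 1) • a) := rfl

theorem delta_apply (p : Octonion) (X : J) : delta p X =
    h1 0 0 0 (p ⋆ X.2 0) (X.2 1 ⋆ p) (-(p ⋆ X.2 2 + X.2 2 ⋆ p)) := rfl

theorem sigma_apply (X : J) : sigma X =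
    h1 (X.1 0) (X.1 1) (X.1 2) (X.2 0) (-X.2 1) (-X.2 2) := rfl

/-! ### The Jordan product -/

theorem jordan_comm (X Y : J) : jordan X Y = jordan Y X := by
  apply J.ext' <;> simp only [jordan, h1_fst_zero, h1_fst_one, h1_fst_two, h1_snd_zero, h1_snd_one,
    h1_snd_two, oinner_comm (Y.2 _) (X.2 _)] <;> first | ring1 | module

theorem jordan_add (X Y Z : J) : jordan X (Y + Z) = jordan X Y + jordan X Z := by
  apply J.ext' <;> simp only [jordan, h1_fst_zero, h1_fst_one, h1_fst_two, h1_snd_zero, h1_snd_one,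
    h1_snd_two, Prod.fst_add, Prod.snd_add, Pi.add_apply, omul_add, add_omul, oconj_add,
        oinner_add] <;> first | ring1 | module

theorem jordan_smul (c : ℝ) (X Y : J) : jordan X (c • Y) = c • jordan X Y := by
  apply J.ext' <;> simp only [jordan, h1_fst_zero, h1_fst_one, h1_fst_two, h1_snd_zero, h1_snd_one,
    h1_snd_two, Prod.smul_fst, Prod.smul_snd, Pi.smul_apply, omul_smul, smul_omul, oconj_smul,
        oinner_smul, smul_eq_mul] <;> first | ring1 | module

theorem add_jordan (X Y Z : J) : jordan (X + Y) Z = jordan X Z + jordan Y Z := by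
  rw [jordan_comm, jordan_add, jordan_comm Z X, jordan_comm Z Y]

theorem smul_jordan (c : ℝ) (X Y : J) : jordan (c • X) Y = c • jordan X Y := by
  rw [jordan_comm, jordan_smul, jordan_comm Y X]

/-- The Jordan product as a continuous bilinear map. -/
def jordanCLM : J →L[ℝ] J →L[ℝ] J :=
  (LinearMap.mk₂ ℝ jordan add_jordan smul_jordan jordan_add jordan_smul).toContinuousBilinearMap

theorem jordanCLM_apply (X Y : J) : jordanCLM X Y = jordan X Y := rfl

theorem jordan_zero (X : J) : jordan X 0 = 0 := map_zero (jordanCLM X)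
theorem zero_jordan (X : J) : jordan 0 X = 0 := by rw [jordan_comm, jordan_zero]

theorem tr_eq (X : J) : tr X = X.1 0 + X.1 1 + X.1 2 := Fin.sum_univ_three _

theorem tr_add (X Y : J) : tr (X + Y) = tr X + tr Y := by
  simp only [tr_eq, Prod.fst_add, Pi.add_apply]; ring

theorem tr_smul (c : ℝ) (X : J) : tr (c • X) = c * tr X := by
  simp only [tr_eq, Prod.smul_fst, Pi.smul_apply, smul_eq_mul]; ring

theorem ip_eq (X Y : J) : ip X Y = X.1 0 * Y.1 0 + X.1 1 * Y.1 1 + X.1 2 * Y.1 2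
    + 2 * oinner (X.2 0) (Y.2 0) - 2 * oinner (X.2 1) (Y.2 1) - 2 * oinner (X.2 2) (Y.2 2) := by
  rw [ip, tr_eq]
  simp only [jordan, h1_fst_zero, h1_fst_one, h1_fst_two]
  ring

theorem ip_comm (X Y : J) : ip X Y = ip Y X := by rw [ip, jordan_comm, ip]

theorem ip_add (X Y Z : J) : ip X (Y + Z) = ip X Y + ip X Z := by
  rw [ip, jordan_add, tr_add, ip, ip]

theorem ip_smul (c : ℝ) (X Y : J) : ip X (c • Y) = c * ip X Y := by
  rw [ip, jordan_smul, tr_smul, ip]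

theorem add_ip (X Y Z : J) : ip (X + Y) Z = ip X Z + ip Y Z := by
  rw [ip_comm, ip_add, ip_comm Z, ip_comm Z]

theorem smul_ip (c : ℝ) (X Y : J) : ip (c • X) Y = c * ip X Y := by
  rw [ip_comm, ip_smul, ip_comm Y]

theorem ip_E2 (X : J) : ip X E2 = X.1 1 := by
  rw [ip_eq]; simp [E2, h1, oinner]

/-- Each diagonal idempotent contributes its `ξᵢ`, and each of the eight directions of an
off-diagonal slot contributes half the sum of two `ξ`'s, so every `ξᵢ` occurs `1 + 8` times. This
expresses `tr` through the algebra structure alone, hence its invariance under automorphisms. -/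
theorem trace_jordanCLM (X : J) :
    LinearMap.trace ℝ J (jordanCLM X : J →ₗ[ℝ] J) = 9 * tr X := by
  rw [LinearMap.trace_eq_matrix_trace ℝ
    ((Pi.basisFun ℝ (Fin 3)).prod (Pi.basis fun _ : Fin 3 => Pi.basisFun ℝ (Fin 8))),
    Matrix.trace, Fintype.sum_sum_type, Fintype.sum_sigma]
  simp only [Matrix.diag_apply, LinearMap.toMatrix_apply, Module.Basis.prod_repr_inl,
    Module.Basis.prod_repr_inr, Pi.basis_repr, Pi.basisFun_repr, ContinuousLinearMap.coe_coe,
    jordanCLM_apply, Module.Basis.prod_apply, Sum.elim_inl, Sum.elim_inr, Function.comp_apply,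
    LinearMap.inl_apply, LinearMap.inr_apply, Pi.basis_apply, Pi.basisFun_apply,
    Fin.sum_univ_three, jordan, h1_fst_zero, h1_fst_one, h1_fst_two, h1_snd_zero, h1_snd_one,
    h1_snd_two, tr_eq]
  simp [Fin.sum_univ_eight, omul_zero, zero_omul, oconj_zero, oinner_zero]
  ring

/-! ### Octonion identities -/

theorem omul_apply_0 (x y : Octonion) : (x ⋆ y) 0 =
    x 0 * y 0 - x 1 * y 1 - x 2 * y 2 - x 3 * y 3 - x 4 * y 4 - x 5 * y 5 - x 6 * y 6 - x 7 * y 7 := by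
  rw [omul_eq]; rfl

theorem omul_apply_1 (x y : Octonion) : (x ⋆ y) 1 =
    x 0 * y 1 + x 1 * y 0 + x 2 * y 3 - x 3 * y 2 - x 5 * y 4 + x 4 * y 5 + x 7 * y 6 - x 6 * y 7 := by
  rw [omul_eq]; rfl

theorem omul_apply_2 (x y : Octonion) : (x ⋆ y) 2 =
    x 0 * y 2 - x 1 * y 3 + x 2 * y 0 + x 3 * y 1 - x 6 * y 4 - x 7 * y 5 + x 4 * y 6 + x 5 * y 7 := by
  rw [omul_eq]; rfl

theorem omul_apply_3 (x y : Octonion) : (x ⋆ y) 3 =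
    x 0 * y 3 + x 1 * y 2 - x 2 * y 1 + x 3 * y 0 - x 7 * y 4 + x 6 * y 5 - x 5 * y 6 + x 4 * y 7 := by
  rw [omul_eq]; rfl

theorem omul_apply_4 (x y : Octonion) : (x ⋆ y) 4 =
    x 0 * y 4 - x 1 * y 5 - x 2 * y 6 - x 3 * y 7 + x 4 * y 0 + x 5 * y 1 + x 6 * y 2 + x 7 * y 3 := by
  rw [omul_eq]; rfl

theorem omul_apply_5 (x y : Octonion) : (x ⋆ y) 5 =
    x 1 * y 4 + x 0 * y 5 + x 3 * y 6 - x 2 * y 7 - x 4 * y 1 + x 5 * y 0 - x 6 * y 3 + x 7 * y 2 := by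
  rw [omul_eq]; rfl

theorem omul_apply_6 (x y : Octonion) : (x ⋆ y) 6 =
    x 2 * y 4 - x 3 * y 5 + x 0 * y 6 + x 1 * y 7 - x 4 * y 2 + x 5 * y 3 + x 6 * y 0 - x 7 * y 1 := by
  rw [omul_eq]; rfl

theorem omul_apply_7 (x y : Octonion) : (x ⋆ y) 7 =
    x 3 * y 4 + x 2 * y 5 - x 1 * y 6 + x 0 * y 7 - x 4 * y 3 - x 5 * y 2 + x 6 * y 1 + x 7 * y 0 := by
  rw [omul_eq]; rfl

theorem oconj_apply_0 (x : Octonion) : oconj x 0 = x 0 := by rw [oconj_eq]; rfl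

theorem oconj_apply_1 (x : Octonion) : oconj x 1 = -x 1 := by rw [oconj_eq]; rfl

theorem oconj_apply_2 (x : Octonion) : oconj x 2 = -x 2 := by rw [oconj_eq]; rfl

theorem oconj_apply_3 (x : Octonion) : oconj x 3 = -x 3 := by rw [oconj_eq]; rfl

theorem oconj_apply_4 (x : Octonion) : oconj x 4 = -x 4 := by rw [oconj_eq]; rfl

theorem oconj_apply_5 (x : Octonion) : oconj x 5 = -x 5 := by rw [oconj_eq]; rfl

theorem oconj_apply_6 (x : Octonion) : oconj x 6 = -x 6 := by rw [oconj_eq]; rfl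

theorem oconj_apply_7 (x : Octonion) : oconj x 7 = -x 7 := by rw [oconj_eq]; rfl

theorem Octonion.ext' {x y : Octonion} (h0 : x 0 = y 0) (h1 : x 1 = y 1) (h2 : x 2 = y 2)
    (h3 : x 3 = y 3) (h4 : x 4 = y 4) (h5 : x 5 = y 5) (h6 : x 6 = y 6) (h7 : x 7 = y 7) :
    x = y := by
  funext i; fin_cases i <;> assumption

/-- Polarization of `x̄(xa) = (x|x)a`; together with its mirror image it is what makes the `Ãᵢ¹(a)`
derivations. -/
theorem oconj_omul_omul_add (x y a : Octonion) :
    oconj x ⋆ (y ⋆ a) + oconj y ⋆ (x ⋆ a) = (2 * oinner x y) • a := by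
  apply Octonion.ext' <;>
  simp only [omul_apply_0, omul_apply_1, omul_apply_2, omul_apply_3, omul_apply_4, omul_apply_5,
    omul_apply_6, omul_apply_7, oconj_apply_0, oconj_apply_1, oconj_apply_2, oconj_apply_3,
    oconj_apply_4, oconj_apply_5, oconj_apply_6, oconj_apply_7, oinner_eq, Pi.add_apply,
    Pi.smul_apply, smul_eq_mul] <;> ring

theorem omul_omul_oconj_add (x y a : Octonion) :
    (a ⋆ x) ⋆ oconj y + (a ⋆ y) ⋆ oconj x = (2 * oinner x y) • a := by
  apply Octonion.ext' <;>
  simp only [omul_apply_0, omul_apply_1, omul_apply_2, omul_apply_3, omul_apply_4, omul_apply_5,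
    omul_apply_6, omul_apply_7, oconj_apply_0, oconj_apply_1, oconj_apply_2, oconj_apply_3,
    oconj_apply_4, oconj_apply_5, oconj_apply_6, oconj_apply_7, oinner_eq, Pi.add_apply,
    Pi.smul_apply, smul_eq_mul] <;> ring

/-- The linearized left alternative law: the associator is skew in its first two arguments. The next
two identities are skewness in the last two arguments and cyclic invariance; they give the three
off-diagonal components of `isDer_delta`. -/
theorem omul_omul_add_left (p u v : Octonion) :
    p ⋆ (u ⋆ v) + u ⋆ (p ⋆ v) = (p ⋆ u) ⋆ v + (u ⋆ p) ⋆ v := by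
  apply Octonion.ext' <;>
  simp only [omul_apply_0, omul_apply_1, omul_apply_2, omul_apply_3, omul_apply_4, omul_apply_5,
    omul_apply_6, omul_apply_7, oconj_apply_0, oconj_apply_1, oconj_apply_2, oconj_apply_3,
    oconj_apply_4, oconj_apply_5, oconj_apply_6, oconj_apply_7, oinner_eq, Pi.add_apply,
    Pi.smul_apply, smul_eq_mul] <;> ring

theorem omul_omul_add_right (p u v : Octonion) :
    (u ⋆ v) ⋆ p + (u ⋆ p) ⋆ v = u ⋆ (v ⋆ p) + u ⋆ (p ⋆ v) := by
  apply Octonion.ext' <;>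
  simp only [omul_apply_0, omul_apply_1, omul_apply_2, omul_apply_3, omul_apply_4, omul_apply_5,
    omul_apply_6, omul_apply_7, oconj_apply_0, oconj_apply_1, oconj_apply_2, oconj_apply_3,
    oconj_apply_4, oconj_apply_5, oconj_apply_6, oconj_apply_7, oinner_eq, Pi.add_apply,
    Pi.smul_apply, smul_eq_mul] <;> ring

theorem omul_omul_flexible (p u v : Octonion) :
    p ⋆ (u ⋆ v) + (u ⋆ v) ⋆ p = u ⋆ (v ⋆ p) + (p ⋆ u) ⋆ v := by
  apply Octonion.ext' <;>
  simp only [omul_apply_0, omul_apply_1, omul_apply_2, omul_apply_3, omul_apply_4, omul_apply_5,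
    omul_apply_6, omul_apply_7, oconj_apply_0, oconj_apply_1, oconj_apply_2, oconj_apply_3,
    oconj_apply_4, oconj_apply_5, oconj_apply_6, oconj_apply_7, oinner_eq, Pi.add_apply,
    Pi.smul_apply, smul_eq_mul] <;> ring

theorem oinner_oconj_oconj (x y : Octonion) : oinner (oconj x) (oconj y) = oinner x y := by
  simp only [omul_apply_0, omul_apply_1, omul_apply_2, omul_apply_3, omul_apply_4, omul_apply_5,
    omul_apply_6, omul_apply_7, oconj_apply_0, oconj_apply_1, oconj_apply_2, oconj_apply_3,
    oconj_apply_4, oconj_apply_5, oconj_apply_6, oconj_apply_7, oinner_eq]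
  ring

theorem oconj_eq_neg {p : Octonion} (hp : p 0 = 0) : oconj p = -p := by
  rw [oconj_eq]
  apply Octonion.ext' <;> simp [hp]

theorem oinner_omul_left {p : Octonion} (hp : p 0 = 0) (x y : Octonion) :
    oinner (p ⋆ x) y = -oinner x (p ⋆ y) := by
  simp only [omul_apply_0, omul_apply_1, omul_apply_2, omul_apply_3, omul_apply_4, omul_apply_5,
    omul_apply_6, omul_apply_7, oconj_apply_0, oconj_apply_1, oconj_apply_2, oconj_apply_3,
    oconj_apply_4, oconj_apply_5, oconj_apply_6, oconj_apply_7, oinner_eq]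
  rw [hp]
  ring

/-! ### Derivations -/

/-- Derivations of the Jordan algebra. -/
def IsDer (D : EndJ) : Prop := ∀ X Y : J, D (jordan X Y) = jordan (D X) Y + jordan X (D Y)

theorem IsDer.add {D D' : EndJ} (h : IsDer D) (h' : IsDer D') : IsDer (D + D') := fun X Y => by
  simp only [add_apply, h X Y, h' X Y, add_jordan, jordan_add]; abel

theorem IsDer.smul {D : EndJ} (c : ℝ) (h : IsDer D) : IsDer (c • D) := fun X Y => by
  simp only [smul_apply, h X Y, smul_jordan, jordan_smul, smul_add]

theorem IsDer.neg {D : EndJ} (h : IsDer D) : IsDer (-D) := by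
  rw [← neg_one_smul ℝ D]; exact h.smul (-1)

theorem IsDer.sub {D D' : EndJ} (h : IsDer D) (h' : IsDer D') : IsDer (D - D') := by
  rw [sub_eq_add_neg]; exact h.add h'.neg

/-- The diagonal components are polynomial identities in real coordinates. The off-diagonal ones,
once conjugations are distributed, are combinations of the polarized norm identities. `isDer_A2` and
`isDer_A3` follow the same pattern. -/
theorem isDer_A1 (a : Octonion) : IsDer (A1 a) := fun X Y => by
  apply J.ext' <;> simp only [A1_apply, jordan, h1_fst_zero, h1_fst_one, h1_fst_two,
    h1_snd_zero, h1_snd_one, h1_snd_two, Prod.fst_add, Prod.snd_add, Pi.add_apply] <;>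
    generalize X.2 0 = x0, X.2 1 = x1, X.2 2 = x2, Y.2 0 = y0, Y.2 1 = y1, Y.2 2 = y2
  iterate 3
    · simp only [omul_apply_0, omul_apply_1, omul_apply_2, omul_apply_3, omul_apply_4, omul_apply_5,
        omul_apply_6, omul_apply_7, oconj_apply_0, oconj_apply_1, oconj_apply_2, oconj_apply_3,
        oconj_apply_4, oconj_apply_5, oconj_apply_6, oconj_apply_7, oinner_eq, Pi.add_apply,
        Pi.sub_apply, Pi.neg_apply, Pi.smul_apply, smul_eq_mul]
      ring
  all_goals
    simp only [sub_eq_add_neg, omul_add, add_omul, oconj_add, omul_smul, smul_omul, oconj_smul,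
      omul_neg, neg_omul, oconj_neg, oconj_omul, oconj_oconj]
  · linear_combination (norm := module) (-1 / 2 : ℝ) • oconj_omul_omul_add x2 y2 a +
      (1 / 2 : ℝ) • omul_omul_oconj_add x1 y1 a
  · linear_combination (norm := module) (-1 / 2 : ℝ) • oconj_omul_omul_add a x0 y1 +
      (-1 / 2 : ℝ) • oconj_omul_omul_add a y0 x1
  · linear_combination (norm := module) (1 / 2 : ℝ) • omul_omul_oconj_add a y0 x2 +
      (1 / 2 : ℝ) • omul_omul_oconj_add a x0 y2

theorem isDer_A2 (a : Octonion) : IsDer (A2 a) := fun X Y => by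
  apply J.ext' <;> simp only [A2_apply, jordan, h1_fst_zero, h1_fst_one, h1_fst_two,
    h1_snd_zero, h1_snd_one, h1_snd_two, Prod.fst_add, Prod.snd_add, Pi.add_apply] <;>
    generalize X.2 0 = x0, X.2 1 = x1, X.2 2 = x2, Y.2 0 = y0, Y.2 1 = y1, Y.2 2 = y2
  iterate 3
    · simp only [omul_apply_0, omul_apply_1, omul_apply_2, omul_apply_3, omul_apply_4, omul_apply_5,
        omul_apply_6, omul_apply_7, oconj_apply_0, oconj_apply_1, oconj_apply_2, oconj_apply_3,
        oconj_apply_4, oconj_apply_5, oconj_apply_6, oconj_apply_7, oinner_eq, Pi.add_apply,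
        Pi.sub_apply, Pi.neg_apply, Pi.smul_apply, smul_eq_mul]
      ring
  all_goals
    simp only [sub_eq_add_neg, omul_add, add_omul, oconj_add, omul_smul, smul_omul, oconj_smul,
      omul_neg, neg_omul, oconj_neg, oconj_omul, oconj_oconj]
  · linear_combination (norm := module) (-1 / 2 : ℝ) • omul_omul_oconj_add a y1 x0 +
      (-1 / 2 : ℝ) • omul_omul_oconj_add a x1 y0
  · linear_combination (norm := module) (1 / 2 : ℝ) • oconj_omul_omul_add x0 y0 a +
      (1 / 2 : ℝ) • omul_omul_oconj_add x2 y2 a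
  · linear_combination (norm := module) (1 / 2 : ℝ) • oconj_omul_omul_add a x1 y2 +
      (1 / 2 : ℝ) • oconj_omul_omul_add a y1 x2

theorem isDer_A3 (a : Octonion) : IsDer (A3 a) := fun X Y => by
  apply J.ext' <;> simp only [A3_apply, jordan, h1_fst_zero, h1_fst_one, h1_fst_two,
    h1_snd_zero, h1_snd_one, h1_snd_two, Prod.fst_add, Prod.snd_add, Pi.add_apply] <;>
    generalize X.2 0 = x0, X.2 1 = x1, X.2 2 = x2, Y.2 0 = y0, Y.2 1 = y1, Y.2 2 = y2
  iterate 3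
    · simp only [omul_apply_0, omul_apply_1, omul_apply_2, omul_apply_3, omul_apply_4, omul_apply_5,
        omul_apply_6, omul_apply_7, oconj_apply_0, oconj_apply_1, oconj_apply_2, oconj_apply_3,
        oconj_apply_4, oconj_apply_5, oconj_apply_6, oconj_apply_7, oinner_eq, Pi.add_apply,
        Pi.sub_apply, Pi.neg_apply, Pi.smul_apply, smul_eq_mul]
      ring
  all_goals
    simp only [sub_eq_add_neg, omul_add, add_omul, oconj_add, omul_smul, smul_omul, oconj_smul,
      omul_neg, neg_omul, oconj_neg, oconj_omul, oconj_oconj]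
  · linear_combination (norm := module) (1 / 2 : ℝ) • oconj_omul_omul_add a x2 y0 +
      (1 / 2 : ℝ) • oconj_omul_omul_add a y2 x0
  · linear_combination (norm := module) (-1 / 2 : ℝ) • omul_omul_oconj_add a y2 x1 +
      (-1 / 2 : ℝ) • omul_omul_oconj_add a x2 y1
  · linear_combination (norm := module) (-1 / 2 : ℝ) • oconj_omul_omul_add x1 y1 a +
      (-1 / 2 : ℝ) • omul_omul_oconj_add x0 y0 a

theorem isDer_delta {p : Octonion} (hp : p 0 = 0) : IsDer (delta p) := fun X Y => by
  have hc := oconj_eq_neg hp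
  apply J.ext' <;> simp only [delta_apply, jordan, h1_fst_zero, h1_fst_one, h1_fst_two,
    h1_snd_zero, h1_snd_one, h1_snd_two, Prod.fst_add, Prod.snd_add, Pi.add_apply] <;>
    generalize X.2 0 = x0, X.2 1 = x1, X.2 2 = x2, Y.2 0 = y0, Y.2 1 = y1, Y.2 2 = y2
  iterate 3
    · simp only [omul_apply_0, omul_apply_1, omul_apply_2, omul_apply_3, omul_apply_4, omul_apply_5,
        omul_apply_6, omul_apply_7, oconj_apply_0, oconj_apply_1, oconj_apply_2, oconj_apply_3,
        oconj_apply_4, oconj_apply_5, oconj_apply_6, oconj_apply_7, oinner_eq, Pi.add_apply,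
        Pi.sub_apply, Pi.neg_apply, Pi.smul_apply, smul_eq_mul, hp]
      ring
  all_goals
    simp only [sub_eq_add_neg, omul_add, add_omul, oconj_add, omul_smul, smul_omul, oconj_smul,
      omul_neg, neg_omul, oconj_neg, oconj_omul, oconj_oconj, hc]
  · linear_combination (norm := module) (-1 / 2 : ℝ) • omul_omul_add_left p (oconj y2) (oconj x1) +
      (-1 / 2 : ℝ) • omul_omul_add_left p (oconj x2) (oconj y1)
  · linear_combination (norm := module) (1 / 2 : ℝ) • omul_omul_add_right p (oconj y0) (oconj x2) +
      (1 / 2 : ℝ) • omul_omul_add_right p (oconj x0) (oconj y2)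
  · linear_combination (norm := module) (-1 / 2 : ℝ) • omul_omul_flexible p (oconj y1) (oconj x0) +
      (-1 / 2 : ℝ) • omul_omul_flexible p (oconj x1) (oconj y0)

/-! ### Exponentials -/

theorem expGL_zero : expGL 0 = 1 := Units.ext NormedSpace.exp_zero

theorem expGL_neg (X : EndJ) : expGL (-X) = (expGL X)⁻¹ := by
  ext1
  rfl

theorem hasDerivAt_expGL (D : EndJ) (t : ℝ) :
    HasDerivAt (fun t : ℝ => (expGL (t • D) : EndJ)) (D * (expGL (t • D) : EndJ)) t :=
  hasDerivAt_exp_smul_const' D t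

theorem hasDerivAt_expGL_apply (D : EndJ) (v : J) (t : ℝ) :
    HasDerivAt (fun t : ℝ => (expGL (t • D) : EndJ) v) (D ((expGL (t • D) : EndJ) v)) t := by
  simpa using (hasDerivAt_expGL D t).clm_apply (hasDerivAt_const t v)

theorem units_apply_inv (g : GLJ) (X : J) : (g : EndJ) (((g⁻¹ : GLJ) : EndJ) X) = X := by
  rw [← mul_apply_eq_comp, Units.mul_inv]; rfl

theorem units_inv_apply (g : GLJ) (X : J) : ((g⁻¹ : GLJ) : EndJ) ((g : EndJ) X) = X := by
  rw [← mul_apply_eq_comp, Units.inv_mul]; rfl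

/-- The solution of a linear differential equation with constant coefficients. -/
theorem expGL_apply_of_hasDerivAt (D : EndJ) (f : ℝ → J)
    (hf : ∀ t, HasDerivAt f (D (f t)) t) (t : ℝ) : (expGL (t • D) : EndJ) (f 0) = f t := by
  -- Uniqueness of solutions: in the derivative of `exp(-tD) f(t)` the two terms cancel, so this
  -- curve is constant.
  have key : ∀ t, HasDerivAt (fun t : ℝ => (expGL (t • -D) : EndJ) (f t)) 0 t := fun t => by
    have h := (hasDerivAt_exp_smul_const (-D) t).clm_apply (hf t)
    refine h.congr_deriv ?_
    simp
  have hc := is_const_of_deriv_eq_zero (fun t => (key t).differentiableAt)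
    (fun t => (key t).deriv) t 0
  simp only [zero_smul, expGL_zero, smul_neg, expGL_neg, Units.val_one] at hc
  rw [← units_apply_inv (expGL (t • D)) (f t), hc]
  simp

theorem expGL_apply_of_eq_zero {D : EndJ} {v : J} (h : D v = 0) : (expGL D : EndJ) v = v := by
  simpa using expGL_apply_of_hasDerivAt D (fun _ => v)
    (fun t => by simpa [h] using hasDerivAt_const t v) 1

theorem expGL_apply_of_eigen {D : EndJ} {v : J} {c : ℝ} (h : D v = c • v) :
    (expGL D : EndJ) v = Real.exp c • v := by
  have := expGL_apply_of_hasDerivAt D (fun t => Real.exp (t * c) • v)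
    (fun t => by
      refine (((hasDerivAt_id t).mul_const c).exp.smul_const v).congr_deriv ?_
      simp [h, smul_smul]) 1
  simpa using this

/-- By the Leibniz rule the product of the curves `exp(tD)X` and `exp(tD)Y` solves `f' = Df`, as
does `exp(tD)(X ∘ Y)`, with the same initial value. -/
theorem IsDer.expGL_mem {D : EndJ} (hD : IsDer D) : expGL D ∈ F4 := by
  intro X Y
  have := expGL_apply_of_hasDerivAt D
    (fun t => jordan ((expGL (t • D) : EndJ) X) ((expGL (t • D) : EndJ) Y)) (fun t => by
      have h := jordanCLM.hasDerivAt_of_bilinear (fun _ => hasDerivAt_expGL_apply D X t)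
        (fun _ => hasDerivAt_expGL_apply D Y t)
      refine h.congr_deriv ?_
      rw [hD, jordanCLM_apply, jordanCLM_apply, add_comm]) 1
  simpa [expGL_zero] using this

/-- One direction differentiates the automorphism identity at `t = 0`. From here on the Lie algebra
is handled through derivations only. -/
theorem mem_f4_iff {D : EndJ} : D ∈ f4 ↔ IsDer D := by
  refine ⟨fun h X Y => ?_, fun h t => (h.smul t).expGL_mem⟩
  have h1 := hasDerivAt_expGL_apply D (jordan X Y) 0
  have h2 := jordanCLM.hasDerivAt_of_bilinear (fun _ => hasDerivAt_expGL_apply D X 0)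
    (fun _ => hasDerivAt_expGL_apply D Y 0)
  have h3 : (fun t : ℝ => (expGL (t • D) : EndJ) (jordan X Y)) =
      fun t => jordanCLM ((expGL (t • D) : EndJ) X) ((expGL (t • D) : EndJ) Y) :=
    funext fun t => h t X Y
  rw [h3] at h1
  have := h1.unique h2
  simp only [zero_smul, expGL_zero, Units.val_one, one_apply_eq_self, jordanCLM_apply] at this
  rw [this, add_comm]

/-! ### Invariance of the trace and of the inner product -/

theorem jordanCLM_apply_eq_conj (g : GLJ) (hg : g ∈ F4) (X : J) :
    jordanCLM ((g : EndJ) X) = (g : EndJ) * jordanCLM X * ((g⁻¹ : GLJ) : EndJ) := by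
  refine ContinuousLinearMap.ext fun Y => ?_
  rw [mul_apply_eq_comp, mul_apply_eq_comp, jordanCLM_apply, jordanCLM_apply, hg, units_apply_inv]

/-- Multiplication by `gX` is the conjugate by `g` of multiplication by `X`, so both operators have
the same trace. -/
theorem tr_apply {g : GLJ} (hg : g ∈ F4) (X : J) : tr ((g : EndJ) X) = tr X := by
  have h1 := trace_jordanCLM ((g : EndJ) X)
  have h2 : ((jordanCLM ((g : EndJ) X) : EndJ) : J →ₗ[ℝ] J) =
      ((g : EndJ) : J →ₗ[ℝ] J) * ((jordanCLM X : EndJ) : J →ₗ[ℝ] J) *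
        (((g⁻¹ : GLJ) : EndJ) : J →ₗ[ℝ] J) := by
    rw [jordanCLM_apply_eq_conj g hg]; rfl
  have h3 : (((g⁻¹ : GLJ) : EndJ) : J →ₗ[ℝ] J) * ((g : EndJ) : J →ₗ[ℝ] J) = 1 :=
    LinearMap.ext fun Y => units_inv_apply g Y
  rw [h2, LinearMap.trace_mul_comm, ← mul_assoc, h3, one_mul, trace_jordanCLM] at h1
  linarith

theorem ip_apply {g : GLJ} (hg : g ∈ F4) (X Y : J) : ip ((g : EndJ) X) ((g : EndJ) Y) = ip X Y := by
  rw [ip, ← hg, tr_apply hg, ip]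

theorem ip_inv_apply {g : GLJ} (hg : g ∈ F4) (X Y : J) :
    ip (((g⁻¹ : GLJ) : EndJ) X) Y = ip X ((g : EndJ) Y) := by
  rw [← ip_apply hg, units_apply_inv]

/-- Multiplication by `DX` is the commutator of `D` with multiplication by `X`, hence traceless. -/
theorem IsDer.tr_eq_zero {D : EndJ} (hD : IsDer D) (X : J) : tr (D X) = 0 := by
  have h1 := trace_jordanCLM (D X)
  have h2 : ((jordanCLM (D X) : EndJ) : J →ₗ[ℝ] J) =
      (D : J →ₗ[ℝ] J) * ((jordanCLM X : EndJ) : J →ₗ[ℝ] J) -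
        ((jordanCLM X : EndJ) : J →ₗ[ℝ] J) * (D : J →ₗ[ℝ] J) :=
    LinearMap.ext fun Y => by
      change jordan (D X) Y = D (jordan X Y) - jordan X (D Y)
      rw [hD]; abel
  rw [h2, map_sub, LinearMap.trace_mul_comm, sub_self] at h1
  linarith

theorem IsDer.ip_eq_neg {D : EndJ} (hD : IsDer D) (X Y : J) : ip (D X) Y = -ip X (D Y) := by
  have h := hD.tr_eq_zero (jordan X Y)
  rw [hD, tr_add] at h
  rw [ip, ip]
  linarith

/-! ### Restricted root spaces -/

theorem oinner_oe (x : Octonion) (i : Fin 8) : oinner x (oe i) = x i := by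
  simp [oinner, oe, Pi.single_apply]

theorem oe_oinner (x : Octonion) (i : Fin 8) : oinner (oe i) x = x i := by
  rw [oinner_comm, oinner_oe]

theorem oconj_oe_zero : oconj (oe 0) = oe 0 := by
  rw [oconj_eq]; apply Octonion.ext' <;> simp [oe]

theorem map_eq_sum_oe (φ : Octonion →ₗ[ℝ] ℝ) (y : Octonion) : φ y = ∑ i, y i * φ (oe i) := by
  conv_lhs => rw [pi_eq_sum_univ' y]
  simp [oe]

theorem A3_one_apply (X : J) : A3 (oe 0) X =
    h1 (-2 * X.2 2 0) (2 * X.2 2 0) 0 (oconj (X.2 1)) (oconj (X.2 0))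
      (-(X.1 0 - X.1 1) • oe 0) := by
  rw [A3_apply, oe_oinner, omul_oe_zero, oe_zero_omul]

/-! ### Weights of `Ã₃¹(1)` on `𝒥¹` -/

/-- `P⁺`, of weight `-2`. -/
def Pplus : J := h1 (-1) 1 0 0 0 (-oe 0)

/-- `E₃`. -/
def E3 : J := h1 0 0 1 0 0 0

theorem weight_iff {c : ℝ} {X : J} : A3 (oe 0) X = c • X ↔
    -2 * X.2 2 0 = c * X.1 0 ∧ 2 * X.2 2 0 = c * X.1 1 ∧ 0 = c * X.1 2 ∧
      oconj (X.2 1) = c • X.2 0 ∧ oconj (X.2 0) = c • X.2 1 ∧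
      -(X.1 0 - X.1 1) • oe 0 = c • X.2 2 := by
  rw [A3_one_apply]
  refine ⟨fun h => ?_, fun ⟨h1, h2, h3, h4, h5, h6⟩ => J.ext' h1 h2 h3 h4 h5 h6⟩
  exact ⟨congrArg (fun X : J => X.1 0) h, congrArg (fun X : J => X.1 1) h,
    congrArg (fun X : J => X.1 2) h, congrArg (fun X : J => X.2 0) h,
    congrArg (fun X : J => X.2 1) h, congrArg (fun X : J => X.2 2) h⟩

theorem A3_one_Pminus : A3 (oe 0) Pminus = (2 : ℝ) • Pminus := by
  rw [weight_iff]
  simp [Pminus, h1, oconj_zero, oe]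
  norm_num

theorem A3_one_Pplus : A3 (oe 0) Pplus = (-2 : ℝ) • Pplus := by
  rw [weight_iff]
  simp [Pplus, h1, oconj_zero, oe]
  norm_num

theorem A3_one_Qplus (x : Octonion) : A3 (oe 0) (Qplus x) = (1 : ℝ) • Qplus x := by
  rw [weight_iff]
  simp [Qplus, h1, oconj_oconj]

theorem A3_one_F3 {q : Octonion} (hq : q 0 = 0) : A3 (oe 0) (F3 q) = (0 : ℝ) • F3 q := by
  rw [weight_iff]
  simp [F3, h1, oconj_zero, hq]

theorem A3_one_E3 : A3 (oe 0) E3 = (0 : ℝ) • E3 := by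
  rw [weight_iff]
  simp [E3, h1, oconj_zero]

/-- A vector of nonzero weight other than `±1` has no components `x₁`, `x₂`. -/
theorem snd_eq_zero_of_weight {c : ℝ} {X : J} (h : A3 (oe 0) X = c • X) (hc : c ^ 2 ≠ 1) :
    X.2 0 = 0 ∧ X.2 1 = 0 := by
  obtain ⟨-, -, -, h4, h5, -⟩ := weight_iff.1 h
  have h6 : (1 - c ^ 2) • X.2 0 = 0 := by
    have := congrArg oconj h5
    rw [oconj_oconj, oconj_smul, h4] at this
    linear_combination (norm := module) this
  have h7 : X.2 0 = 0 := (smul_eq_zero.1 h6).resolve_left fun h => hc (by linarith)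
  refine ⟨h7, ?_⟩
  rw [← oconj_oconj (X.2 1), h4, h7, smul_zero, oconj_zero]

/-- A vector of weight other than `0`, `±2` has only the components `x₁`, `x₂`. -/
theorem fst_eq_zero_of_weight {c : ℝ} {X : J} (h : A3 (oe 0) X = c • X) (c0 : c ≠ 0)
    (hc : c ^ 2 ≠ 4) : X.1 = 0 ∧ X.2 2 = 0 := by
  obtain ⟨h1, h2, h3, -, -, h6⟩ := weight_iff.1 h
  have h7 := congrFun h6 0
  simp only [Pi.smul_apply, oe, Pi.single_eq_same, smul_eq_mul] at h7
  have h8 : X.2 2 0 = 0 := by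
    have : (c ^ 2 - 4) * X.2 2 0 = 0 := by linear_combination -c * h7 + h1 - h2
    exact (mul_eq_zero.1 this).resolve_left (sub_ne_zero.2 hc)
  have h9 : X.1 0 = 0 := by simpa [h8, c0] using h1
  have h10 : X.1 1 = 0 := by simpa [h8, c0] using h2
  refine ⟨funext fun i => ?_, by simpa [h9, h10, c0] using h6.symm⟩
  fin_cases i
  · exact h9
  · exact h10
  · simpa [c0] using h3

theorem eq_zero_of_weight {c : ℝ} {X : J} (hc : 2 < c) (h : A3 (oe 0) X = c • X) : X = 0 := by
  obtain ⟨h1, h2⟩ := snd_eq_zero_of_weight h (by nlinarith)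
  obtain ⟨h3, h4⟩ := fst_eq_zero_of_weight h (by linarith) (by nlinarith)
  exact J.ext' (congrFun h3 0) (congrFun h3 1) (congrFun h3 2) h1 h2 h4

/-- The top weight space is a line, and `ξ₂` is a coordinate on it since `Pminus` has `ξ₂ = 1`. This
is why pairing with `E₂` captures all the information needed. -/
theorem eq_smul_Pminus {X : J} (h : A3 (oe 0) X = (2 : ℝ) • X) : X = X.1 1 • Pminus := by
  obtain ⟨h4, h5⟩ := snd_eq_zero_of_weight h (by norm_num)
  obtain ⟨h1, h2, h3, -, -, h6⟩ := weight_iff.1 h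
  have h0 : X.1 0 = -X.1 1 := by linarith
  apply J.ext'
  · simp [Pminus, F4Iwasawa.h1, h0]
  · simp [Pminus, F4Iwasawa.h1]
  · simp [Pminus, F4Iwasawa.h1]; linarith
  · simp [Pminus, F4Iwasawa.h1, h4]
  · simp [Pminus, F4Iwasawa.h1, h5]
  · simp only [Pminus, F4Iwasawa.h1, Prod.smul_snd, Pi.smul_apply, Matrix.cons_val]
    rw [h0] at h6
    linear_combination (norm := module) (-1 / 2 : ℝ) • h6

/-- The weight spaces `-1` and `1` are in duality: here `x₂ = -x̄₁`, so the pairing with `Q⁺(x₁)` is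
`4 (x₁|x₁)`. -/
theorem eq_zero_of_weight_neg_one {X : J} (h : A3 (oe 0) X = (-1 : ℝ) • X)
    (hQ : ∀ y, ip X (Qplus y) = 0) : X = 0 := by
  obtain ⟨h1, h2, h3, h4, h5, h6⟩ := weight_iff.1 h
  have h7 : X.2 0 = 0 := by
    apply oinner_self_eq_zero
    have := hQ (X.2 0)
    rw [ip_eq] at this
    simp only [Qplus, h1_fst_zero, h1_fst_one, h1_fst_two, h1_snd_zero, h1_snd_one, h1_snd_two,
      h5, oinner_smul, oinner_zero] at this
    have h8 : oinner (X.2 1) (X.2 1) = oinner (X.2 0) (X.2 0) := by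
      rw [← oinner_oconj_oconj, h4, smul_oinner, oinner_smul]; ring
    linarith
  have h8 := congrFun h6 0
  simp only [Pi.smul_apply, oe, Pi.single_eq_same, smul_eq_mul] at h8
  have h9 : X.1 0 = 0 := by linarith
  have h10 : X.1 1 = 0 := by linarith
  refine J.ext' h9 h10 (by simpa using h3) h7 ?_ ?_
  · simpa [h7, oconj_zero] using h5
  · simpa [h9, h10] using h6

/-- The weight `0` space is spanned by `E₁ + E₂`, `E₃` and the imaginary `F₃¹(q)`; the last two
kinds of coefficient are detected by the pairings, the first then by the trace. -/
theorem eq_zero_of_weight_zero {X : J} (h : A3 (oe 0) X = (0 : ℝ) • X)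
    (hF : ∀ q : Octonion, q 0 = 0 → ip X (F3 q) = 0) (h3 : ip X E3 = 0) (htr : tr X = 0) :
    X = 0 := by
  obtain ⟨h4, h5⟩ := snd_eq_zero_of_weight h (by norm_num)
  obtain ⟨h1, h2, -, -, -, h6⟩ := weight_iff.1 h
  have h7 : X.1 2 = 0 := by
    rw [ip_eq] at h3
    simpa [E3, F4Iwasawa.h1, oinner_zero] using h3
  have h8 : X.2 2 = 0 := by
    apply oinner_self_eq_zero
    have := hF (X.2 2) (by linarith)
    rw [ip_eq] at this
    simpa [F3, F4Iwasawa.h1, oinner_zero] using this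
  have h9 := congrFun h6 0
  simp only [Pi.smul_apply, oe, Pi.single_eq_same, smul_eq_mul] at h9
  rw [tr_eq] at htr
  exact J.ext' (by simp; linarith) (by simp; linarith) h7 h4 h5 h8

/-! ### Root vectors as derivations shifting weights -/

theorem mem_rootSpace {c : ℝ} {Z : EndJ} :
    Z ∈ rootSpace c ↔ IsDer Z ∧ ∀ X, A3 (oe 0) (Z X) - Z (A3 (oe 0) X) = c • Z X := by
  rw [rootSpace, Set.mem_ofPred_eq, mem_f4_iff]
  exact and_congr_right fun _ => ContinuousLinearMap.ext_iff

theorem weight_apply {c d : ℝ} {Z : EndJ} (hZ : Z ∈ rootSpace c) {X : J}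
    (hX : A3 (oe 0) X = d • X) : A3 (oe 0) (Z X) = (c + d) • Z X := by
  have h := (mem_rootSpace.1 hZ).2 X
  rw [hX, map_smul] at h
  linear_combination (norm := module) h

theorem rootSpace_sub {c : ℝ} {Z W : EndJ} (hZ : Z ∈ rootSpace c) (hW : W ∈ rootSpace c) :
    Z - W ∈ rootSpace c := by
  rw [mem_rootSpace] at *
  refine ⟨hZ.1.sub hW.1, fun X => ?_⟩
  simp only [sub_apply, map_sub]
  linear_combination (norm := module) hZ.2 X - hW.2 X

theorem rootSpace_smul {c : ℝ} {Z : EndJ} (r : ℝ) (hZ : Z ∈ rootSpace c) :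
    r • Z ∈ rootSpace c := by
  rw [mem_rootSpace] at *
  refine ⟨hZ.1.smul r, fun X => ?_⟩
  simp only [smul_apply, map_smul]
  linear_combination (norm := module) r • hZ.2 X

/-- `Ã₃¹(1)` is an inner derivation, so automorphisms fixing `E₁` and `F₃¹(1)`, and derivations
killing them, commute with it. -/
theorem A3_one_eq_commutator (X : J) : A3 (oe 0) X =
    (4 : ℝ) • (jordan E1 (jordan (F3 (oe 0)) X) - jordan (F3 (oe 0)) (jordan E1 X)) := by
  rw [A3_one_apply]
  apply J.ext' <;> simp only [jordan, E1, F3, h1_fst_zero, h1_fst_one, h1_fst_two, h1_snd_zero,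
    h1_snd_one, h1_snd_two, Prod.smul_fst, Prod.smul_snd, Prod.fst_sub, Prod.snd_sub,
    Pi.sub_apply, Pi.smul_apply] <;>
    simp only [omul_zero, zero_omul, oconj_zero, oinner_zero, zero_oinner, oinner_smul, oe_oinner, omul_oe_zero, oe_zero_omul, oconj_smul, smul_omul, omul_smul,
    smul_eq_mul, omul_add, add_omul, oconj_add, oinner_add, sub_eq_add_neg, oconj_neg,
    oinner_neg, omul_neg, neg_omul] <;>
    first | ring1 | module

/-- A derivation in a nonzero root space which kills `E₁` and `F₃¹(1)` vanishes, as it commutes with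
`Ã₃¹(1)`. -/
theorem eq_zero_of_mem_rootSpace {c : ℝ} (hc : c ≠ 0) {Z : EndJ} (hZ : Z ∈ rootSpace c)
    (h1 : Z E1 = 0) (h2 : Z (F3 (oe 0)) = 0) : Z = 0 := by
  obtain ⟨hD, hZ⟩ := mem_rootSpace.1 hZ
  refine ContinuousLinearMap.ext fun X => ?_
  have h := hZ X
  rw [A3_one_eq_commutator X, A3_one_eq_commutator (Z X), map_smul, map_sub, hD, hD, hD, hD, h1,
    h2] at h
  simp only [zero_jordan, zero_add, sub_self] at h
  simpa [hc] using h.symm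

theorem Pplus_add_Pminus : jordan (Pplus + Pminus) (Pplus + Pminus) = (4 : ℝ) • (E1 + E2) := by
  apply J.ext' <;> simp only [jordan, E1, E2, Pplus, Pminus, h1_fst_zero, h1_fst_one, h1_fst_two,
    h1_snd_zero, h1_snd_one, h1_snd_two, Prod.fst_add, Prod.snd_add, Pi.add_apply, add_zero,
    zero_add, omul_zero, zero_omul, oconj_zero, oinner_zero, zero_oinner, neg_add_cancel,
    Prod.smul_fst, Prod.smul_snd, Pi.smul_apply, smul_eq_mul] <;>
    first | ring1 | module

/-- `P⁻` is killed because there is no weight above `2`. If `P⁺` is killed too, so is the square of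
`P⁺ + P⁻`, which is `4(E₁ + E₂)`; these elements span `E₁` and `F₃¹(1)`. -/
theorem eq_zero_of_Pplus {c : ℝ} (hc : 0 < c) {Z : EndJ} (hZ : Z ∈ rootSpace c)
    (h : Z Pplus = 0) : Z = 0 := by
  have hD := (mem_rootSpace.1 hZ).1
  have h' : Z Pminus = 0 := eq_zero_of_weight (by linarith) (weight_apply hZ A3_one_Pminus)
  have hF : F3 (oe 0) = (1 / 2 : ℝ) • (Pminus - Pplus) := by
    apply J.ext' <;> simp [F3, Pminus, Pplus, h1] <;> module
  have hs : Z (E1 + E2) = 0 := by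
    have := hD (Pplus + Pminus) (Pplus + Pminus)
    rw [Pplus_add_Pminus, map_add Z Pplus, h, h', add_zero, zero_jordan, jordan_zero, add_zero,
      map_smul] at this
    exact (smul_eq_zero.1 this).resolve_left (by norm_num)
  have hE : E1 = (1 / 2 : ℝ) • (E1 + E2) - (1 / 4 : ℝ) • (Pplus + Pminus) := by
    apply J.ext' <;> simp [E1, E2, Pminus, Pplus, h1] <;> norm_num
  refine eq_zero_of_mem_rootSpace hc.ne' hZ ?_ ?_
  · rw [hE, map_sub, map_smul, map_smul, hs, map_add, h, h']; simp
  · rw [hF, map_smul, map_sub, h, h']; simp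

/-- `Z P⁺` has weight `-1` and, by skewness of `Z`, pairs to zero with every `Q⁺(y)`. -/
theorem eq_zero_of_Qplus {Z : EndJ} (hZ : Z ∈ rootSpace 1) (h : ∀ y, Z (Qplus y) = 0) : Z = 0 := by
  have hD := (mem_rootSpace.1 hZ).1
  refine eq_zero_of_Pplus one_pos hZ (eq_zero_of_weight_neg_one ?_ fun y => ?_)
  · convert weight_apply hZ A3_one_Pplus using 2; norm_num
  · rw [hD.ip_eq_neg, h, ip, jordan_zero, tr_eq]; simp

/-- `Z P⁺` has weight `0`, so by skewness it suffices that `Z` also kills `E₃`. Indeed `Z E₃` is a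
multiple of `P⁻`, which `E₃` annihilates, while `E₃² = E₃` gives `Z E₃ = 2 E₃ ∘ Z E₃`. -/
theorem eq_zero_of_F3 {Z : EndJ} (hZ : Z ∈ rootSpace 2)
    (h : ∀ q : Octonion, q 0 = 0 → Z (F3 q) = 0) : Z = 0 := by
  have hD := (mem_rootSpace.1 hZ).1
  have ip0 : ∀ X, ip X 0 = 0 := fun X => by rw [ip, jordan_zero, tr_eq]; simp
  have h3 : Z E3 = 0 := by
    have h1 := weight_apply hZ A3_one_E3
    rw [add_zero] at h1
    have h2 := eq_smul_Pminus h1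
    have h3 : jordan E3 E3 = E3 := by
      apply J.ext' <;> simp [jordan, E3, F4Iwasawa.h1, omul_zero, oconj_zero, oinner_zero]
    have h4 := hD E3 E3
    have h5 : jordan E3 Pminus = 0 := by
      apply J.ext' <;> simp [jordan, E3, Pminus, F4Iwasawa.h1, omul_zero, zero_omul, oconj_zero,
        oinner_zero, zero_oinner]
    rw [h3, jordan_comm _ E3, h2, jordan_smul, h5] at h4
    rw [h2, h4]; simp
  refine eq_zero_of_Pplus two_pos hZ (eq_zero_of_weight_zero ?_ (fun q hq => ?_) ?_ ?_)
  · convert weight_apply hZ A3_one_Pplus using 2; norm_num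
  · rw [hD.ip_eq_neg, h q hq, ip0, neg_zero]
  · rw [hD.ip_eq_neg, h3, ip0, neg_zero]
  · exact hD.tr_eq_zero _

/-! ### The elements `𝒢₁(x)` and `𝒢₂(p)` -/

theorem oe_zero_eq : oe 0 = ![1, 0, 0, 0, 0, 0, 0, 0] := by
  ext i; fin_cases i <;> simp [oe]

theorem G1_apply (x : Octonion) (X : J) : G1 x X =
    h1 (-(2 * oinner (oconj x) (X.2 1))) (2 * oinner x (X.2 0))
      (2 * oinner (oconj x) (X.2 1) - 2 * oinner x (X.2 0))
      (-(X.1 1 - X.1 2) • x + oconj (oconj x ⋆ X.2 2))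
      (-oconj (X.2 2 ⋆ x) + (X.1 2 - X.1 0) • oconj x)
      (oconj (x ⋆ X.2 1) + oconj (X.2 0 ⋆ oconj x)) := by
  apply J.ext' <;> simp only [G1, add_apply, A1_apply, A2_apply, h1_fst_zero, h1_fst_one, h1_fst_two, h1_snd_zero, h1_snd_one, h1_snd_two,
      Prod.fst_add, Prod.snd_add, Prod.fst_sub, Prod.snd_sub, Prod.smul_fst, Prod.smul_snd,
      Pi.add_apply, Pi.sub_apply, Pi.smul_apply] <;>
    (try simp only [omul_neg, neg_omul, oconj_neg, neg_oinner]) <;> first | ring1 | module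

theorem G2_apply (p : Octonion) (X : J) : G2 p X =
    h1 (2 * oinner p (X.2 2)) (-(2 * oinner p (X.2 2))) 0
      (-oconj (X.2 1 ⋆ p) - p ⋆ X.2 0) (-oconj (p ⋆ X.2 0) - X.2 1 ⋆ p)
      ((X.1 0 - X.1 1) • p + (p ⋆ X.2 2 + X.2 2 ⋆ p)) := by
  apply J.ext' <;> simp only [G2, sub_apply, A3_apply, delta_apply, h1_fst_zero, h1_fst_one, h1_fst_two, h1_snd_zero, h1_snd_one, h1_snd_two,
      Prod.fst_add, Prod.snd_add, Prod.fst_sub, Prod.snd_sub, Prod.smul_fst, Prod.smul_snd,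
      Pi.add_apply, Pi.sub_apply, Pi.smul_apply] <;>
    (try simp only [omul_neg, neg_omul, oconj_neg, neg_oinner]) <;> first | ring1 | module

theorem isDer_G1 (x : Octonion) : IsDer (G1 x) := (isDer_A1 _).add (isDer_A2 _)

theorem isDer_G2 {p : Octonion} (hp : p 0 = 0) : IsDer (G2 p) := (isDer_A3 _).sub (isDer_delta hp)

theorem G1_mem_rootSpace (x : Octonion) : G1 x ∈ rootSpace 1 := by
  refine mem_rootSpace.2 ⟨isDer_G1 x, fun X => ?_⟩
  apply J.ext' <;> simp only [G1_apply, A3_one_apply, h1_fst_zero, h1_fst_one, h1_fst_two, h1_snd_zero, h1_snd_one, h1_snd_two,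
      Prod.fst_add, Prod.snd_add, Prod.fst_sub, Prod.snd_sub, Prod.smul_fst, Prod.smul_snd,
      Pi.add_apply, Pi.sub_apply, Pi.smul_apply]
  iterate 3
    · simp only [omul_apply_0, omul_apply_1, omul_apply_2, omul_apply_3, omul_apply_4, omul_apply_5,
    omul_apply_6, omul_apply_7, oconj_apply_0, oconj_apply_1, oconj_apply_2, oconj_apply_3,
    oconj_apply_4, oconj_apply_5, oconj_apply_6, oconj_apply_7, oinner_eq, Pi.add_apply,
    Pi.sub_apply, Pi.neg_apply, Pi.smul_apply, smul_eq_mul, oe_zero_eq, Matrix.cons_val]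
      ring
  all_goals
    apply Octonion.ext' <;> simp only [omul_apply_0, omul_apply_1, omul_apply_2, omul_apply_3, omul_apply_4, omul_apply_5,
    omul_apply_6, omul_apply_7, oconj_apply_0, oconj_apply_1, oconj_apply_2, oconj_apply_3,
    oconj_apply_4, oconj_apply_5, oconj_apply_6, oconj_apply_7, oinner_eq, Pi.add_apply,
    Pi.sub_apply, Pi.neg_apply, Pi.smul_apply, smul_eq_mul, oe_zero_eq, Matrix.cons_val] <;>
      ring

theorem G2_mem_rootSpace {p : Octonion} (hp : p 0 = 0) : G2 p ∈ rootSpace 2 := by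
  refine mem_rootSpace.2 ⟨isDer_G2 hp, fun X => ?_⟩
  apply J.ext' <;> simp only [G2_apply, A3_one_apply, h1_fst_zero, h1_fst_one, h1_fst_two, h1_snd_zero, h1_snd_one, h1_snd_two,
      Prod.fst_add, Prod.snd_add, Prod.fst_sub, Prod.snd_sub, Prod.smul_fst, Prod.smul_snd,
      Pi.add_apply, Pi.sub_apply, Pi.smul_apply]
  iterate 3
    · simp only [omul_apply_0, omul_apply_1, omul_apply_2, omul_apply_3, omul_apply_4, omul_apply_5,
    omul_apply_6, omul_apply_7, oconj_apply_0, oconj_apply_1, oconj_apply_2, oconj_apply_3,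
    oconj_apply_4, oconj_apply_5, oconj_apply_6, oconj_apply_7, oinner_eq, Pi.add_apply,
    Pi.sub_apply, Pi.neg_apply, Pi.smul_apply, smul_eq_mul, oe_zero_eq, Matrix.cons_val, hp]
      ring
  all_goals
    apply Octonion.ext' <;> simp only [omul_apply_0, omul_apply_1, omul_apply_2, omul_apply_3, omul_apply_4, omul_apply_5,
    omul_apply_6, omul_apply_7, oconj_apply_0, oconj_apply_1, oconj_apply_2, oconj_apply_3,
    oconj_apply_4, oconj_apply_5, oconj_apply_6, oconj_apply_7, oinner_eq, Pi.add_apply,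
    Pi.sub_apply, Pi.neg_apply, Pi.smul_apply, smul_eq_mul, oe_zero_eq, Matrix.cons_val, hp] <;>
      ring

theorem G1_Pminus (x : Octonion) : G1 x Pminus = 0 :=
  eq_zero_of_weight (by norm_num) (weight_apply (G1_mem_rootSpace x) A3_one_Pminus)

theorem G2_Pminus {p : Octonion} (hp : p 0 = 0) : G2 p Pminus = 0 :=
  eq_zero_of_weight (by norm_num) (weight_apply (G2_mem_rootSpace hp) A3_one_Pminus)

theorem G2_Qplus {p : Octonion} (hp : p 0 = 0) (y : Octonion) : G2 p (Qplus y) = 0 :=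
  eq_zero_of_weight (by norm_num) (weight_apply (G2_mem_rootSpace hp) (A3_one_Qplus y))

theorem G1_Qplus (x y : Octonion) : G1 x (Qplus y) = (2 * oinner x y) • Pminus := by
  rw [eq_smul_Pminus (X := G1 x (Qplus y))]
  · rw [G1_apply]; rfl
  · convert weight_apply (G1_mem_rootSpace x) (A3_one_Qplus y) using 2; norm_num

theorem G1_F3 (x : Octonion) {q : Octonion} (hq : q 0 = 0) :
    G1 x (F3 q) = Qplus (-(q ⋆ x)) := by
  apply J.ext' <;> simp only [G1_apply, F3, Qplus, h1_fst_zero, h1_fst_one, h1_fst_two, h1_snd_zero, h1_snd_one, h1_snd_two, oinner_zero,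
    omul_zero, zero_omul, oconj_zero, oconj_omul, oconj_oconj, oconj_eq_neg hq, neg_omul, omul_neg,
    oconj_neg, neg_neg] <;>
  first | ring1 | module

theorem G2_F3 {p q : Octonion} (hp : p 0 = 0) (hq : q 0 = 0) :
    G2 p (F3 q) = (-2 * oinner p q) • Pminus := by
  rw [eq_smul_Pminus (X := G2 p (F3 q))]
  · rw [G2_apply, neg_mul]; rfl
  · convert weight_apply (G2_mem_rootSpace hp) (A3_one_F3 hq) using 2; norm_num

theorem Qplus_add (x y : Octonion) : Qplus (x + y) = Qplus x + Qplus y := by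
  apply J.ext' <;> simp [Qplus, h1, oconj_add]

theorem Qplus_smul (c : ℝ) (x : Octonion) : Qplus (c • x) = c • Qplus x := by
  apply J.ext' <;> simp [Qplus, h1, oconj_smul]

theorem F3_add (x y : Octonion) : F3 (x + y) = F3 x + F3 y := by
  apply J.ext' <;> simp [F3, h1]

theorem F3_smul (c : ℝ) (x : Octonion) : F3 (c • x) = c • F3 x := by
  apply J.ext' <;> simp [F3, h1]

/-- `Q⁺` as a linear map. -/
def QplusL : Octonion →ₗ[ℝ] J where
  toFun := Qplus
  map_add' := Qplus_add
  map_smul' := Qplus_smul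

/-- `F₃¹` as a linear map. -/
def F3L : Octonion →ₗ[ℝ] J where
  toFun := F3
  map_add' := F3_add
  map_smul' := F3_smul

/-- The linear form `X ↦ ξ₂`. -/
def xi2 : J →ₗ[ℝ] ℝ := LinearMap.proj 1 ∘ₗ LinearMap.fst ℝ _ _

/-! ### Parametrization of `𝔫⁺` by `𝒢₁` and `𝒢₂` -/

theorem exists_eq_G1 {Z : EndJ} (hZ : Z ∈ rootSpace 1) : ∃ x, Z = G1 x := by
  let φ : Octonion →ₗ[ℝ] ℝ := xi2 ∘ₗ (Z : J →ₗ[ℝ] J) ∘ₗ QplusL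
  -- The vector representing the linear form `φ`; the factor `1/2` compensates the `2` in
  -- `G1_Qplus`.
  let x : Octonion := fun i => 1 / 2 * φ (oe i)
  refine ⟨x, sub_eq_zero.1 (eq_zero_of_Qplus (rootSpace_sub hZ (G1_mem_rootSpace x)) fun y => ?_)⟩
  have h1 : Z (Qplus y) = φ y • Pminus := eq_smul_Pminus (by
    convert weight_apply hZ (A3_one_Qplus y) using 2; norm_num)
  have h2 : φ y = 2 * oinner x y := by
    rw [map_eq_sum_oe, oinner, Finset.mul_sum]
    refine Finset.sum_congr rfl fun i _ => ?_
    simp only [x]; ring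
  rw [sub_apply, h1, h2, G1_Qplus, sub_self]

theorem exists_eq_G2 {Z : EndJ} (hZ : Z ∈ rootSpace 2) : ∃ p : Octonion, p 0 = 0 ∧ Z = G2 p := by
  let φ : Octonion →ₗ[ℝ] ℝ := xi2 ∘ₗ (Z : J →ₗ[ℝ] J) ∘ₗ F3L
  -- The real part is set to `0` so that `p` is imaginary; `φ (oe 0)` is irrelevant because only
  -- imaginary `q` are tested.
  let p : Octonion := fun i => if i = 0 then 0 else -(1 / 2) * φ (oe i)
  have hp : p 0 = 0 := if_pos rfl
  refine ⟨p, hp, sub_eq_zero.1 (eq_zero_of_F3 (rootSpace_sub hZ (G2_mem_rootSpace hp))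
    fun q hq => ?_)⟩
  have h1 : Z (F3 q) = φ q • Pminus := eq_smul_Pminus (by
    convert weight_apply hZ (A3_one_F3 hq) using 2; norm_num)
  have h2 : φ q = -2 * oinner p q := by
    rw [map_eq_sum_oe, oinner, Finset.mul_sum]
    refine Finset.sum_congr rfl fun i _ => ?_
    by_cases hi : i = 0
    · simp [hi, hq]
    · simp only [p, if_neg hi]; ring
  rw [sub_apply, h1, h2, G2_F3 hp hq, sub_self]

theorem mem_nplus {X : EndJ} : X ∈ nplus ↔ ∃ x p : Octonion, p 0 = 0 ∧ X = G1 x + G2 p := by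
  rw [nplus, Set.mem_add]
  constructor
  · rintro ⟨Z, hZ, W, hW, rfl⟩
    obtain ⟨x, rfl⟩ := exists_eq_G1 hZ
    obtain ⟨p, hp, rfl⟩ := exists_eq_G2 hW
    exact ⟨x, p, hp, rfl⟩
  · rintro ⟨x, p, hp, rfl⟩
    exact ⟨_, G1_mem_rootSpace x, _, G2_mem_rootSpace hp, rfl⟩

/-! ### Action of `N⁺` and `A` on weight vectors -/

theorem expGL_apply_of_sq_eq_zero {D : EndJ} {v : J} (h : D (D v) = 0) :
    (expGL D : EndJ) v = v + D v := by
  have := expGL_apply_of_hasDerivAt D (fun t => v + t • D v) (fun t => by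
    refine (((hasDerivAt_id t).smul_const (D v)).const_add v).congr_deriv ?_
    simp [h]) 1
  simpa using this

theorem expGL_nplus_Pminus (x : Octonion) {p : Octonion} (hp : p 0 = 0) :
    (expGL (G1 x + G2 p) : EndJ) Pminus = Pminus :=
  expGL_apply_of_eq_zero (by rw [add_apply, G1_Pminus, G2_Pminus hp, add_zero])

theorem expGL_nplus_Qplus (x : Octonion) {p : Octonion} (hp : p 0 = 0) (y : Octonion) :
    (expGL (G1 x + G2 p) : EndJ) (Qplus y) = Qplus y + (2 * oinner x y) • Pminus := by
  have h : (G1 x + G2 p) (Qplus y) = (2 * oinner x y) • Pminus := by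
    rw [add_apply, G1_Qplus, G2_Qplus hp, add_zero]
  rw [expGL_apply_of_sq_eq_zero, h]
  rw [h, map_smul, add_apply, G1_Pminus, G2_Pminus hp, add_zero, smul_zero]

theorem expGL_nplus_F3 (x : Octonion) {p q : Octonion} (hp : p 0 = 0) (hq : q 0 = 0) :
    (expGL (G1 x + G2 p) : EndJ) (F3 q) =
      F3 q + (Qplus (-(q ⋆ x)) + (-2 * oinner p q) • Pminus) := by
  have h : (G1 x + G2 p) (F3 q) = Qplus (-(q ⋆ x)) + (-2 * oinner p q) • Pminus := by
    rw [add_apply, G1_F3 x hq, G2_F3 hp hq]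
  -- The second-order term of the exponential is proportional to `(x|qx)`, which vanishes since left
  -- multiplication by an imaginary octonion is skew. So the series stops at first order.
  have h0 : oinner x (q ⋆ x) = 0 := by
    have := oinner_omul_left hq x x
    rw [oinner_comm] at this
    linarith
  rw [expGL_apply_of_sq_eq_zero, h]
  rw [h, map_add, map_smul, add_apply, add_apply, G1_Pminus, G2_Pminus hp, G1_Qplus, G2_Qplus hp,
    oinner_neg, h0]
  simp

theorem expGL_mem_F4_of_nplus (x : Octonion) {p : Octonion} (hp : p 0 = 0) :
    expGL (G1 x + G2 p) ∈ F4 := ((isDer_G1 x).add (isDer_G2 hp)).expGL_mem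

theorem expGL_A3_mem_F4 (t : ℝ) : expGL (t • A3 (oe 0)) ∈ F4 := ((isDer_A3 _).smul t).expGL_mem

theorem expGL_A3_apply {X : J} {c : ℝ} (h : A3 (oe 0) X = c • X) (t : ℝ) :
    (expGL (t • A3 (oe 0)) : EndJ) X = Real.exp (t * c) • X :=
  expGL_apply_of_eigen (by rw [smul_apply, h, smul_smul])

/-! ### The involution `θ_ε` -/

theorem sigma_sigma (X : J) : sigma (sigma X) = X := by
  apply J.ext' <;> simp [sigma_apply, h1]

theorem sigma_jordan (X Y : J) : sigma (jordan X Y) = jordan (sigma X) (sigma Y) := by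
  apply J.ext' <;> simp only [sigma_apply, jordan, h1_fst_zero, h1_fst_one, h1_fst_two, h1_snd_zero, h1_snd_one, h1_snd_two] <;>
    (try simp only [omul_neg, neg_omul, oconj_neg, oinner_neg, neg_oinner]) <;>
    first | ring1 | module

theorem sigma_A3_one (X : J) : sigma (A3 (oe 0) X) = -A3 (oe 0) (sigma X) := by
  apply J.ext' <;> simp [sigma_apply, A3_one_apply, h1, oconj_neg]

theorem theta_apply (Z : EndJ) (X : J) : theta Z X = sigma (Z (sigma X)) := rfl

theorem theta_theta (Z : EndJ) : theta (theta Z) = Z :=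
  ContinuousLinearMap.ext fun X => by simp only [theta_apply, sigma_sigma]

theorem theta_mem_rootSpace {c : ℝ} {Z : EndJ} (hZ : Z ∈ rootSpace c) :
    theta Z ∈ rootSpace (-c) := by
  obtain ⟨hD, h⟩ := mem_rootSpace.1 hZ
  refine mem_rootSpace.2 ⟨fun X Y => ?_, fun X => ?_⟩
  · simp only [theta_apply, sigma_jordan, hD (sigma X), map_add, sigma_sigma]
  · have h1 := congrArg sigma (h (sigma X))
    have h2 : sigma (A3 (oe 0) X) = -A3 (oe 0) (sigma X) := sigma_A3_one X
    simp only [map_sub, sigma_A3_one, map_smul] at h1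
    simp only [theta_apply, h2, map_neg]
    linear_combination (norm := module) -h1

theorem theta_smul (r : ℝ) (Z : EndJ) : theta (r • Z) = r • theta Z := by
  simp only [theta, mul_smul_comm, smul_mul_assoc]

theorem theta_zero : theta 0 = 0 := by simp [theta]

theorem Icc_neg_two_two : Finset.Icc (-2 : ℤ) 2 = {-2, -1, 0, 1, 2} := by decide

theorem zero_mem_rootSpace (c : ℝ) : (0 : EndJ) ∈ rootSpace c :=
  mem_rootSpace.2 ⟨fun X Y => by simp [zero_jordan, jordan_zero], fun X => by simp⟩

theorem theta_neg (Z : EndJ) : theta (-Z) = -theta Z :=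
  ContinuousLinearMap.ext fun X => by simp [theta_apply]

theorem rootSpace_neg {c : ℝ} {Z : EndJ} (hZ : Z ∈ rootSpace c) : -Z ∈ rootSpace c := by
  simpa using rootSpace_sub (zero_mem_rootSpace c) hZ

/-- `θ_ε` is `-θ` on `𝔤_{±α}`, and `θ` is an involution exchanging them, so `θ_ε` exchanges `Z` and
`-θZ`. -/
theorem sub_theta_mem_keps {Z : EndJ} (hZ : Z ∈ rootSpace 1) : Z - theta Z ∈ keps := by
  have hZ' := rootSpace_neg (theta_mem_rootSpace hZ)
  refine ⟨mem_f4_iff.2 ?_, fun j => if j = 1 then Z else if j = -1 then -theta Z else 0,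
    ?_, ?_, ?_⟩
  · exact (mem_rootSpace.1 hZ).1.sub (mem_rootSpace.1 (theta_mem_rootSpace hZ)).1
  · intro j _
    by_cases h1 : j = 1
    · simpa [h1] using hZ
    by_cases h2 : j = -1
    · simpa [h2] using hZ'
    · simpa [h1, h2] using zero_mem_rootSpace j
  · simp [Icc_neg_two_two, sub_eq_add_neg, add_comm]
  · refine ContinuousLinearMap.ext fun X => ?_
    simp [Icc_neg_two_two, theta_zero, sgn, theta_neg, theta_theta]
    abel

theorem add_theta_mem_keps {Z : EndJ} (hZ : Z ∈ rootSpace 2) : Z + theta Z ∈ keps := by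
  have hZ' := theta_mem_rootSpace hZ
  refine ⟨mem_f4_iff.2 ?_, fun j => if j = 2 then Z else if j = -2 then theta Z else 0,
    ?_, ?_, ?_⟩
  · exact (mem_rootSpace.1 hZ).1.add (mem_rootSpace.1 hZ').1
  · intro j _
    by_cases h1 : j = 2
    · simpa [h1] using hZ
    by_cases h2 : j = -2
    · simpa [h2] using hZ'
    · simpa [h1, h2] using zero_mem_rootSpace j
  · simp [Icc_neg_two_two]; abel
  · simp [Icc_neg_two_two, theta_zero, theta_theta, sgn]

/-- In `𝒢₁(ā) = Ã₁¹(ā) - Ã₂¹(a)` the involution `θ` fixes the first term and negates the second, so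
`𝒢₁(ā) - θ𝒢₁(ā) = -2Ã₂¹(a)`. -/
theorem smul_A2_mem_keps (t : ℝ) (a : Octonion) : t • A2 a ∈ keps := by
  convert sub_theta_mem_keps (rootSpace_smul (-(t / 2)) (G1_mem_rootSpace (oconj a))) using 1
  refine ContinuousLinearMap.ext fun X => ?_
  apply J.ext' <;> simp only [A2_apply, sub_apply, smul_apply, theta_smul, theta_apply, G1_apply,
    sigma_apply, h1_fst_zero, h1_fst_one, h1_fst_two, h1_snd_zero, h1_snd_one, h1_snd_two, Prod.fst_add, Prod.snd_add, Prod.fst_sub, Prod.snd_sub, Prod.smul_fst, Prod.smul_snd,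
      Pi.add_apply, Pi.sub_apply, Pi.smul_apply,
    oconj_oconj] <;>
    (try simp only [omul_neg, neg_omul, oconj_neg, oinner_neg, neg_oinner]) <;>
    first | ring1 | module

/-- `θ` negates `Ã₃¹(-p)` and fixes `δ(p)`, so `𝒢₂(p) + θ𝒢₂(p) = -2δ(p)`. -/
theorem smul_delta_mem_keps (t : ℝ) {p : Octonion} (hp : p 0 = 0) : t • delta p ∈ keps := by
  convert add_theta_mem_keps (rootSpace_smul (-(t / 2)) (G2_mem_rootSpace hp)) using 1
  refine ContinuousLinearMap.ext fun X => ?_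
  apply J.ext' <;> simp only [delta_apply, add_apply, smul_apply, theta_smul, theta_apply,
    G2_apply, sigma_apply, h1_fst_zero, h1_fst_one, h1_fst_two, h1_snd_zero, h1_snd_one, h1_snd_two, Prod.fst_add, Prod.snd_add, Prod.fst_sub, Prod.snd_sub, Prod.smul_fst, Prod.smul_snd,
      Pi.add_apply, Pi.sub_apply, Pi.smul_apply] <;>
    (try simp only [omul_neg, neg_omul, oconj_neg, oinner_neg, neg_oinner]) <;>
    first | ring1 | module

/-! ### `K_ε` fixes `E₂` -/

/-- `E₂` has components of weights `0`, `-2`, `2` only. Hence root vectors of even degree send it to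
even weights and those of odd degree to odd weights. -/
theorem E2_eq_weights :
    E2 = (1 / 2 : ℝ) • (E1 + E2) + (1 / 4 : ℝ) • Pplus + (1 / 4 : ℝ) • Pminus := by
  apply J.ext' <;> simp [E1, E2, Pminus, Pplus, h1] <;> norm_num

theorem A3_one_E1_add_E2 : A3 (oe 0) (E1 + E2) = (0 : ℝ) • (E1 + E2) := by
  rw [weight_iff]
  simp [E1, E2, h1, oconj_zero]

theorem apply_E2_of_even {c : ℝ} {Z : EndJ} (hZ : Z ∈ rootSpace c) (h0 : c ^ 2 ≠ 1)
    (h1 : (c + 2) ^ 2 ≠ 1) (h2 : (c - 2) ^ 2 ≠ 1) : (Z E2).2 0 = 0 ∧ (Z E2).2 1 = 0 := by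
  have a0 := snd_eq_zero_of_weight (weight_apply hZ A3_one_E1_add_E2) (by simpa using h0)
  have a1 := snd_eq_zero_of_weight (weight_apply hZ A3_one_Pplus) (by simpa [sub_eq_add_neg] using h2)
  have a2 := snd_eq_zero_of_weight (weight_apply hZ A3_one_Pminus) h1
  rw [E2_eq_weights, map_add Z, map_add Z, map_smul, map_smul, map_smul]
  simp only [Prod.snd_add, Prod.smul_snd, Pi.add_apply, Pi.smul_apply]
  rw [a0.1, a0.2, a1.1, a1.2, a2.1, a2.2]
  simp

theorem apply_E2_of_odd {c : ℝ} {Z : EndJ} (hZ : Z ∈ rootSpace c) (h : c ^ 2 = 1) :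
    (Z E2).1 = 0 ∧ (Z E2).2 2 = 0 := by
  have hc : c = 1 ∨ c = -1 := sq_eq_sq_iff_eq_or_eq_neg.1 (h.trans (one_pow 2).symm)
  have a0 := fst_eq_zero_of_weight (weight_apply hZ A3_one_E1_add_E2)
    (by rcases hc with rfl | rfl <;> norm_num) (by rcases hc with rfl | rfl <;> norm_num)
  have a1 := fst_eq_zero_of_weight (weight_apply hZ A3_one_Pplus)
    (by rcases hc with rfl | rfl <;> norm_num) (by rcases hc with rfl | rfl <;> norm_num)
  have a2 := fst_eq_zero_of_weight (weight_apply hZ A3_one_Pminus)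
    (by rcases hc with rfl | rfl <;> norm_num) (by rcases hc with rfl | rfl <;> norm_num)
  rw [E2_eq_weights, map_add Z, map_add Z, map_smul, map_smul, map_smul]
  simp only [Prod.fst_add, Prod.smul_fst, Prod.snd_add, Prod.smul_snd, Pi.add_apply, Pi.smul_apply]
  rw [a0.1, a0.2, a1.1, a1.2, a2.1, a2.2]
  simp

theorem jordan_E2 (X : J) : jordan E2 X =
    h1 0 (X.1 1) 0 ((1 / 2 : ℝ) • X.2 0) 0 ((1 / 2 : ℝ) • X.2 2) := by
  apply J.ext' <;> simp only [jordan, E2, h1_fst_zero, h1_fst_one, h1_fst_two, h1_snd_zero, h1_snd_one, h1_snd_two, omul_zero, zero_omul, oconj_zero, oinner_zero, zero_oinner] <;>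
    first | ring1 | module

theorem jordan_E1 (X : J) : jordan E1 X =
    h1 (X.1 0) 0 0 0 ((1 / 2 : ℝ) • X.2 1) ((1 / 2 : ℝ) • X.2 2) := by
  apply J.ext' <;> simp only [jordan, E1, h1_fst_zero, h1_fst_one, h1_fst_two, h1_snd_zero, h1_snd_one, h1_snd_two, omul_zero, zero_omul, oconj_zero, oinner_zero, zero_oinner] <;>
    first | ring1 | module

theorem jordan_E3 (X : J) : jordan E3 X =
    h1 0 0 (X.1 2) ((1 / 2 : ℝ) • X.2 0) ((1 / 2 : ℝ) • X.2 1) 0 := by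
  apply J.ext' <;> simp only [jordan, E3, h1_fst_zero, h1_fst_one, h1_fst_two, h1_snd_zero, h1_snd_one, h1_snd_two, omul_zero, zero_omul, oconj_zero, oinner_zero, zero_oinner] <;>
    first | ring1 | module

/-- Write `X E₂ = u + v` with `u` from the even root spaces and `v` from the odd ones; `u` has no
`x₁`, `x₂` and `v` has only these. Invariance under `θ_ε` says `X E₂ = σu - σv`. Since `σ` fixes the
`x₁` slot and negates the `x₃` slot, both slots of `X E₂` vanish. -/
theorem keps_apply_E2 {X : EndJ} (hX : X ∈ keps) : X E2 = 0 := by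
  obtain ⟨hD, Z, hZ, h1, h2⟩ := hX
  rw [mem_f4_iff] at hD
  have hsum : ∀ f : ℤ → EndJ, ∑ j ∈ Finset.Icc (-2 : ℤ) 2, f j =
      (f (-2) + f 0 + f 2) + (f (-1) + f 1) := fun f => by
    rw [Icc_neg_two_two]; simp; abel
  rw [hsum] at h1 h2
  simp [sgn] at h2
  have e1 := apply_E2_of_even (hZ (-2) (by decide)) (by norm_num) (by norm_num) (by norm_num)
  have e2 := apply_E2_of_even (hZ 0 (by decide)) (by norm_num) (by norm_num) (by norm_num)
  have e3 := apply_E2_of_even (hZ 2 (by decide)) (by norm_num) (by norm_num) (by norm_num)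
  have o1 := apply_E2_of_odd (hZ (-1) (by decide)) (by norm_num)
  have o2 := apply_E2_of_odd (hZ 1 (by decide)) (by norm_num)
  have hs : sigma E2 = E2 := by apply J.ext' <;> simp [sigma_apply, E2, F4Iwasawa.h1]
  have k1 := congrArg (fun X : EndJ => X E2) h1
  have k2 := congrArg (fun X : EndJ => X E2) h2
  simp only [add_apply, smul_apply, theta_apply, hs] at k1 k2
  have a0 : (X E2).2 0 = 0 := by
    have l1 := congrArg (fun X : J => X.2 0) k1
    have l2 := congrArg (fun X : J => X.2 0) k2
    simp [sigma_apply, e1, e2, e3, F4Iwasawa.h1] at l1 l2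
    linear_combination (norm := module) (1 / 2 : ℝ) • l1 + (1 / 2 : ℝ) • l2
  have a2 : (X E2).2 2 = 0 := by
    have l1 := congrArg (fun X : J => X.2 2) k1
    have l2 := congrArg (fun X : J => X.2 2) k2
    simp [sigma_apply, o1, o2, F4Iwasawa.h1] at l1 l2
    linear_combination (norm := module) (1 / 2 : ℝ) • l1 + (1 / 2 : ℝ) • l2
  have hE : jordan E2 E2 = E2 := by
    rw [jordan_E2]; simp [E2, F4Iwasawa.h1]
  -- The Leibniz rule for `E₂² = E₂` gives `X E₂ = 2 E₂ ∘ X E₂`; with `x₁ = x₃ = 0` only `ξ₂` could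
  -- survive, and it satisfies `ξ₂ = 2ξ₂`.
  have h3 := hD E2 E2
  rw [hE, jordan_comm _ E2, jordan_E2, a0, a2] at h3
  have h4 : (X E2).1 1 = 0 := by
    have := congrArg (fun X : J => X.1 1) h3
    simp [F4Iwasawa.h1] at this
    exact this
  rw [h3, h4]
  apply J.ext' <;> simp [F4Iwasawa.h1]

/-! ### `K_ε` is the stabilizer of `E₂` -/

/-- The stabilizer of `E₂` in `F₄₍₋₂₀₎`. -/
def stabE2 : Subgroup GLJ where
  carrier := {g | g ∈ F4 ∧ (g : EndJ) E2 = E2}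
  one_mem' := ⟨F4.one_mem, rfl⟩
  mul_mem' := fun {a b} ha hb => ⟨F4.mul_mem ha.1 hb.1, by
    rw [Units.val_mul, mul_apply_eq_comp, hb.2, ha.2]⟩
  inv_mem' := fun {a} ha => ⟨F4.inv_mem ha.1, by
    conv_lhs => rw [← ha.2]
    exact units_inv_apply a E2⟩

theorem Keps0_le_stabE2 : Keps0 ≤ stabE2 := by
  rw [Keps0, Subgroup.closure_le]
  rintro _ ⟨X, hX, rfl⟩
  exact ⟨(mem_f4_iff.1 hX.1).expGL_mem, expGL_apply_of_eq_zero (keps_apply_E2 hX)⟩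

/-- The element `F₁¹(x)`. -/
def F1 (x : Octonion) : J := h1 0 0 0 x 0 0

/-- The element `F₂¹(x)`. -/
def F2 (x : Octonion) : J := h1 0 0 0 0 x 0

theorem jordan_F1 (y : Octonion) (X : J) : jordan X (F1 y) =
    h1 0 (oinner (X.2 0) y) (oinner (X.2 0) y) ((1 / 2 : ℝ) • (X.1 1 + X.1 2) • y)
      ((1 / 2 : ℝ) • oconj (X.2 2 ⋆ y)) ((1 / 2 : ℝ) • oconj (y ⋆ X.2 1)) := by
  apply J.ext' <;> simp only [jordan, F1, h1_fst_zero, h1_fst_one, h1_fst_two, h1_snd_zero, h1_snd_one, h1_snd_two, omul_zero, zero_omul, oconj_zero, oinner_zero, zero_oinner] <;>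
    first | ring1 | module

theorem oinner_oe_zero_self : oinner (oe 0) (oe 0) = 1 := by
  rw [oinner_oe]; simp [oe]

theorem sigma_apply_comm_of_mem_K {k : GLJ} (hk : k ∈ K) (X : J) :
    sigma ((k : EndJ) X) = (k : EndJ) (sigma X) := by
  have h := congrArg (fun D : EndJ => D (sigma X)) hk.2
  simpa only [mul_apply_eq_comp, sigma_sigma] using h

/-- `E₁` is the only idempotent of trace `1` which is central in the subalgebra of the elements
fixed by `σ`. -/
theorem eq_E1_of_central {e : J} (h1 : jordan e e = e) (h2 : tr e = 1) (h3 : sigma e = e)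
    (h4 : ∀ X, sigma X = X → jordan e (jordan e X) = jordan e X) : e = E1 := by
  have hx1 : e.2 1 = 0 := by
    have h := congrArg (fun X : J => X.2 1) h3
    simp only [sigma_apply, h1_snd_one] at h
    linear_combination (norm := module) (-1 / 2 : ℝ) • h
  have hx2 : e.2 2 = 0 := by
    have h := congrArg (fun X : J => X.2 2) h3
    simp only [sigma_apply, h1_snd_two] at h
    linear_combination (norm := module) (-1 / 2 : ℝ) • h
  have k0 := congrArg (fun X : J => X.1 0) h1
  have k1 := congrArg (fun X : J => X.1 1) h1
  have k2 := congrArg (fun X : J => X.1 2) h1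
  simp only [jordan, h1_fst_zero, h1_fst_one, h1_fst_two, h1_snd_zero, h1_snd_one, h1_snd_two, hx1, hx2, oinner_zero, sub_zero] at k0 k1 k2
  -- In the `ξ₂` slot, the condition tested on `E₂` has half the `(x₁|x₁)` term of the idempotent
  -- equation; comparing them kills `x₁`.
  have hx0 : e.2 0 = 0 := by
    have h := h4 E2 (by apply J.ext' <;> simp [sigma_apply, E2, F4Iwasawa.h1])
    have h5 := congrArg (fun X : J => X.1 1) h
    rw [jordan_comm e E2, jordan_E2] at h5
    simp only [jordan, h1_fst_zero, h1_fst_one, h1_fst_two, h1_snd_zero, h1_snd_one, h1_snd_two, hx1, hx2, oinner_zero, sub_zero, oinner_smul] at h5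
    apply oinner_self_eq_zero
    linarith
  have hF := h4 (F1 (oe 0)) (by apply J.ext' <;> simp [sigma_apply, F1, F4Iwasawa.h1])
  have hF' := congrArg (fun X : J => X.2 0 0) hF
  rw [jordan_F1] at hF'
  simp only [jordan, hx0, hx1, hx2, h1_fst_zero, h1_fst_one, h1_fst_two, h1_snd_zero, h1_snd_one, h1_snd_two, omul_zero, zero_omul, oconj_zero, oinner_zero, zero_oinner, Pi.smul_apply, Pi.add_apply, Pi.sub_apply, smul_eq_mul,
    oe_zero_eq, Matrix.cons_val, Pi.zero_apply] at hF'
  rw [hx0, oinner_zero, add_zero] at k1 k2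
  rw [tr_eq] at h2
  -- With `s = ξ₂ + ξ₃`, the condition on `F₁¹(1)` is `s² / 4 = s / 2`; the root `s = 2` would force
  -- `ξ₁ = -1`, which is not idempotent.
  have s0 : e.1 1 + e.1 2 = 0 := by
    have a : (e.1 1 + e.1 2) * (e.1 1 + e.1 2 - 2) = 0 := by linarith
    rcases mul_eq_zero.1 a with a | a
    · exact a
    · have : e.1 0 = -1 := by linarith
      rw [this] at k0; norm_num at k0
  have p1 : e.1 1 = 0 := by nlinarith
  have p2 : e.1 2 = 0 := by linarith
  exact J.ext' (by simp [E1, F4Iwasawa.h1]; linarith) (by simpa [E1, F4Iwasawa.h1] using p1)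
    (by simpa [E1, F4Iwasawa.h1] using p2) hx0 hx1 hx2

theorem jordan_E1_E1 : jordan E1 E1 = E1 := by
  rw [jordan_E1]; simp [E1, h1]

theorem jordan_E2_E2 : jordan E2 E2 = E2 := by
  rw [jordan_E2]; simp [E2, h1]

theorem tr_E1 : tr E1 = 1 := by rw [tr_eq]; simp [E1, h1]

theorem tr_E2 : tr E2 = 1 := by rw [tr_eq]; simp [E2, h1]

theorem jordan_E1_jordan_E1 {X : J} (hX : sigma X = X) :
    jordan E1 (jordan E1 X) = jordan E1 X := by
  have h1 := congrArg (fun X : J => X.2 1) hX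
  have h2 := congrArg (fun X : J => X.2 2) hX
  simp only [sigma_apply, h1_snd_one, h1_snd_two] at h1 h2
  have hx1 : X.2 1 = 0 := by linear_combination (norm := module) (-1 / 2 : ℝ) • h1
  have hx2 : X.2 2 = 0 := by linear_combination (norm := module) (-1 / 2 : ℝ) • h2
  rw [jordan_E1, jordan_E1, hx1, hx2]
  simp [F4Iwasawa.h1]

theorem E2_eq_A3_A3 : E2 = E1 - (1 / 2 : ℝ) • A3 (oe 0) (A3 (oe 0) E1) := by
  rw [A3_one_apply, A3_one_apply]
  apply J.ext' <;> simp [E1, E2, h1, oconj_zero, oe]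

/-- Commuting with `σ` forces `k E₁ = E₁` by `eq_E1_of_central`; commuting with `Ã₃¹(1)` then
transports this to `E₂`, which is built from `E₁` and `Ã₃¹(1)²E₁`. -/
theorem M_subset_stabE2 {k : GLJ} (hk : k ∈ M) : k ∈ stabE2 := by
  obtain ⟨hK, hA⟩ := hk
  have hF := hK.1
  have hs := sigma_apply_comm_of_mem_K hK
  have h1 : (k : EndJ) E1 = E1 := by
    refine eq_E1_of_central ?_ ?_ ?_ fun X hX => ?_
    · rw [← hF, jordan_E1_E1]
    · rw [tr_apply hF, tr_E1]
    · rw [hs]; congr 1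
      apply J.ext' <;> simp [sigma_apply, E1, F4Iwasawa.h1]
    · obtain ⟨Y, rfl⟩ : ∃ Y, (k : EndJ) Y = X := ⟨_, units_apply_inv k X⟩
      rw [← hF, ← hF, jordan_E1_jordan_E1]
      have := congrArg ((k⁻¹ : GLJ) : EndJ) hX
      rwa [hs, units_inv_apply, units_inv_apply] at this
  have hA' : ∀ X, (k : EndJ) (A3 (oe 0) X) = A3 (oe 0) ((k : EndJ) X) := fun X => by
    have h := congrArg (fun D : EndJ => D ((k : EndJ) X)) hA
    simpa only [mul_apply_eq_comp, units_inv_apply] using h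
  refine ⟨hF, ?_⟩
  conv_lhs => rw [E2_eq_A3_A3]
  rw [map_sub, map_smul, hA', hA', h1, ← E2_eq_A3_A3]

theorem Keps_subset_stabE2 {k : GLJ} (hk : k ∈ Keps) : k ∈ stabE2 := by
  obtain ⟨a, ha, b, hb, rfl⟩ := Set.mem_mul.1 hk
  exact stabE2.mul_mem (Keps0_le_stabE2 ha) (M_subset_stabE2 hb)

/-- Multiplication by `E₁` has eigenvalues `0`, `1`, `½`, and `8λ² - 8λ + 1` takes the values `1`,
`1`, `-1` there. So an automorphism fixing `E₁` commutes with `σ`. -/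
theorem sigma_eq (X : J) :
    sigma X = (8 : ℝ) • jordan E1 (jordan E1 X) - (8 : ℝ) • jordan E1 X + X := by
  rw [jordan_E1, jordan_E1]
  apply J.ext' <;> simp only [sigma_apply, h1_fst_zero, h1_fst_one, h1_fst_two, h1_snd_zero, h1_snd_one, h1_snd_two, Prod.fst_add, Prod.snd_add, Prod.fst_sub, Prod.snd_sub, Prod.smul_fst, Prod.smul_snd,
      Pi.add_apply, Pi.sub_apply, Pi.smul_apply] <;>
    first | ring1 | module

/-- An automorphism fixing `E₁`, `E₂` and `F₃¹(1)` lies in `M`. -/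
theorem mem_M_of_fix {g : GLJ} (hg : g ∈ F4) (h1 : (g : EndJ) E1 = E1)
    (h2 : (g : EndJ) (F3 (oe 0)) = F3 (oe 0)) : g ∈ M := by
  have hE : ∀ X, (g : EndJ) (jordan E1 X) = jordan E1 ((g : EndJ) X) := fun X => by rw [hg, h1]
  have hF : ∀ X, (g : EndJ) (jordan (F3 (oe 0)) X) = jordan (F3 (oe 0)) ((g : EndJ) X) :=
    fun X => by rw [hg, h2]
  refine ⟨⟨hg, ContinuousLinearMap.ext fun X => ?_⟩, ContinuousLinearMap.ext fun X => ?_⟩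
  · have : (g : EndJ) (sigma X) = sigma ((g : EndJ) X) := by
      rw [sigma_eq, sigma_eq, map_add, map_sub, map_smul, map_smul, hE, hE]
    rw [mul_apply_eq_comp, mul_apply_eq_comp, this, sigma_sigma]
  · have : ∀ X, (g : EndJ) (A3 (oe 0) X) = A3 (oe 0) ((g : EndJ) X) := fun X => by
      rw [A3_one_eq_commutator, A3_one_eq_commutator, map_smul, map_sub, hE, hF, hF, hE]
    rw [mul_apply_eq_comp, mul_apply_eq_comp, this, units_apply_inv]

/-! ### The stabilizer of `E₂` is contained in `K_ε` -/

/-- The joint Peirce `½`-space of `E₁` and `E₂`. -/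
theorem eq_F3_of_half {Y : J} (h1 : jordan E1 Y = (1 / 2 : ℝ) • Y)
    (h2 : jordan E2 Y = (1 / 2 : ℝ) • Y) : Y = F3 (Y.2 2) := by
  rw [jordan_E1] at h1
  rw [jordan_E2] at h2
  have a0 := congrArg (fun X : J => X.1 0) h2
  have a1 := congrArg (fun X : J => X.1 1) h1
  have a2 := congrArg (fun X : J => X.1 2) h1
  have a3 := congrArg (fun X : J => X.2 0) h1
  have a4 := congrArg (fun X : J => X.2 1) h2
  simp only [h1_fst_zero, h1_fst_one, h1_fst_two, h1_snd_zero, h1_snd_one, h1_snd_two, Prod.fst_add, Prod.snd_add, Prod.fst_sub, Prod.snd_sub, Prod.smul_fst, Prod.smul_snd,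
      Pi.add_apply, Pi.sub_apply, Pi.smul_apply, smul_eq_mul] at a0 a1 a2 a3 a4
  apply J.ext' <;> simp only [F3, h1_fst_zero, h1_fst_one, h1_fst_two, h1_snd_zero, h1_snd_one, h1_snd_two]
  · linarith
  · linarith
  · linarith
  · linear_combination (norm := module) (-2 : ℝ) • a3
  · linear_combination (norm := module) (-2 : ℝ) • a4

/-- The joint Peirce `½`-space of `E₂` and `E₃`. -/
theorem eq_F1_of_half {Y : J} (h2 : jordan E2 Y = (1 / 2 : ℝ) • Y)
    (h3 : jordan E3 Y = (1 / 2 : ℝ) • Y) : Y = F1 (Y.2 0) := by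
  rw [jordan_E2] at h2
  rw [jordan_E3] at h3
  have a0 := congrArg (fun X : J => X.1 0) h2
  have a1 := congrArg (fun X : J => X.1 1) h3
  have a2 := congrArg (fun X : J => X.1 2) h2
  have a3 := congrArg (fun X : J => X.2 1) h2
  have a4 := congrArg (fun X : J => X.2 2) h3
  simp only [h1_fst_zero, h1_fst_one, h1_fst_two, h1_snd_zero, h1_snd_one, h1_snd_two, Prod.fst_add, Prod.snd_add, Prod.fst_sub, Prod.snd_sub, Prod.smul_fst, Prod.smul_snd,
      Pi.add_apply, Pi.sub_apply, Pi.smul_apply, smul_eq_mul] at a0 a1 a2 a3 a4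
  apply J.ext' <;> simp only [F1, h1_fst_zero, h1_fst_one, h1_fst_two, h1_snd_zero, h1_snd_one, h1_snd_two]
  · linarith
  · linarith
  · linarith
  · linear_combination (norm := module) (-2 : ℝ) • a3
  · linear_combination (norm := module) (-2 : ℝ) • a4

theorem jordan_E1_F3 (x : Octonion) : jordan E1 (F3 x) = (1 / 2 : ℝ) • F3 x := by
  rw [jordan_E1]; apply J.ext' <;> simp [F3, h1]

theorem jordan_E2_F3 (x : Octonion) : jordan E2 (F3 x) = (1 / 2 : ℝ) • F3 x := by
  rw [jordan_E2]; apply J.ext' <;> simp [F3, h1]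

theorem ip_F3_F3 (x y : Octonion) : ip (F3 x) (F3 y) = -2 * oinner x y := by
  rw [ip_eq]; simp [F3, h1, oinner_zero]

theorem ip_F1_F1 (x y : Octonion) : ip (F1 x) (F1 y) = 2 * oinner x y := by
  rw [ip_eq]; simp [F1, h1, oinner_zero]

/-- Otherwise `g` would carry the joint `½`-space of `E₁`, `E₂`, where the form is negative
definite, to that of `E₃`, `E₂`, where it is positive definite. -/
theorem apply_E1_ne_E3 {g : GLJ} (hg : g ∈ stabE2) : (g : EndJ) E1 ≠ E3 := fun h => by
  have h1 := congrArg (g : EndJ) (jordan_E2_F3 (oe 0))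
  have h2 := congrArg (g : EndJ) (jordan_E1_F3 (oe 0))
  rw [hg.1, hg.2, map_smul] at h1
  rw [hg.1, h, map_smul] at h2
  have h3 := eq_F1_of_half h1 h2
  have h4 := ip_apply hg.1 (F3 (oe 0)) (F3 (oe 0))
  rw [h3, ip_F1_F1, ip_F3_F3, oinner_oe_zero_self] at h4
  have := oinner_self_nonneg (((g : EndJ) (F3 (oe 0))).2 0)
  linarith

theorem A2_E1 (a : Octonion) : A2 a E1 = F2 a := by
  apply J.ext' <;> simp [A2_apply, E1, F2, h1, omul_zero, zero_omul, oconj_zero, oinner_zero]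

theorem A2_E3 (a : Octonion) : A2 a E3 = -F2 a := by
  apply J.ext' <;> simp [A2_apply, E3, F2, h1, omul_zero, zero_omul, oconj_zero, oinner_zero]

theorem A2_F2 (a b : Octonion) : A2 a (F2 b) = (2 * oinner a b) • (E1 - E3) := by
  apply J.ext' <;> simp [A2_apply, E1, E3, F2, h1, omul_zero, zero_omul, oconj_zero, oinner_zero]

theorem F2_smul (c : ℝ) (x : Octonion) : F2 (c • x) = c • F2 x := by
  apply J.ext' <;> simp [F2, h1]

/-- `Ã₂¹(u)` kills `E₁ + E₃` and exchanges `E₁ - E₃` and `F₂¹(u)` up to a factor `2`, so its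
exponential is a hyperbolic rotation by `2t` of that plane. -/
theorem expGL_A2_apply {u : Octonion} (hu : oinner u u = 1) (a r t : ℝ) :
    (expGL (t • A2 u) : EndJ) ((1 / 2 : ℝ) • (E1 + E3) + a • (E1 - E3) + r • F2 u) =
      (1 / 2 : ℝ) • (E1 + E3) + (a * Real.cosh (2 * t) + r * Real.sinh (2 * t)) • (E1 - E3) +
        (r * Real.cosh (2 * t) + a * Real.sinh (2 * t)) • F2 u := by
  have h2 : ∀ t, HasDerivAt (fun t : ℝ => 2 * t) 2 t := fun t => by
    simpa using (hasDerivAt_id t).const_mul (2 : ℝ)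
  have h := expGL_apply_of_hasDerivAt (A2 u) (fun t => (1 / 2 : ℝ) • (E1 + E3) +
    (a * Real.cosh (2 * t) + r * Real.sinh (2 * t)) • (E1 - E3) +
        (r * Real.cosh (2 * t) + a * Real.sinh (2 * t)) • F2 u) (fun t => by
      have hc := (h2 t).cosh
      have hs := (h2 t).sinh
      refine (((((hc.const_mul a).add (hs.const_mul r)).smul_const (E1 - E3)).const_add
        ((1 / 2 : ℝ) • (E1 + E3))).add
        (((hc.const_mul r).add (hs.const_mul a)).smul_const (F2 u))).congr_deriv ?_
      simp only [map_add, map_sub, map_smul, A2_E1, A2_E3, A2_F2, hu]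
      module) t
  simpa using h

/-- A boost moves an idempotent orthogonal to `E₂` to `E₁` or `E₃`. -/
theorem exists_boost {e : J} (h1 : jordan e e = e) (h2 : tr e = 1) (h3 : jordan e E2 = 0) :
    ∃ (u : Octonion) (t : ℝ), (expGL (t • A2 u) : EndJ) e = E1 ∨
      (expGL (t • A2 u) : EndJ) e = E3 := by
  rw [jordan_comm, jordan_E2] at h3
  have b1 := congrArg (fun X : J => X.1 1) h3
  have b2 := congrArg (fun X : J => X.2 0) h3
  have b3 := congrArg (fun X : J => X.2 2) h3
  simp [F4Iwasawa.h1] at b1 b2 b3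
  have k0 := congrArg (fun X : J => X.1 0) h1
  have k2 := congrArg (fun X : J => X.1 2) h1
  simp only [jordan, h1_fst_zero, h1_fst_one, h1_fst_two, h1_snd_zero, h1_snd_one, h1_snd_two, b2, b3, oinner_zero, sub_zero, add_zero] at k0 k2
  rw [tr_eq, b1] at h2
  -- Polar form of the remaining off-diagonal entry; any unit vector serves when it is zero.
  obtain ⟨r, u, hu, hr⟩ : ∃ (r : ℝ) (u : Octonion), oinner u u = 1 ∧ e.2 1 = r • u := by
    by_cases hx : e.2 1 = 0
    · exact ⟨0, oe 0, oinner_oe_zero_self, by simpa using hx⟩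
    · have hp : 0 < oinner (e.2 1) (e.2 1) :=
        lt_of_le_of_ne (oinner_self_nonneg _) fun h => hx (oinner_self_eq_zero h.symm)
      have hs := Real.sqrt_pos.2 hp
      refine ⟨√(oinner (e.2 1) (e.2 1)), (√(oinner (e.2 1) (e.2 1)))⁻¹ • e.2 1, ?_, ?_⟩
      · rw [smul_oinner, oinner_smul]
        field_simp
        exact (Real.sq_sqrt hp.le).symm
      · rw [smul_smul, mul_inv_cancel₀ hs.ne', one_smul]
  have he : e = (1 / 2 : ℝ) • (E1 + E3) + ((e.1 0 - e.1 2) / 2) • (E1 - E3) + r • F2 u := by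
    rw [← F2_smul, ← hr]
    apply J.ext' <;> simp only [E1, E3, F2, h1_fst_zero, h1_fst_one, h1_fst_two, h1_snd_zero, h1_snd_one, h1_snd_two, Prod.fst_add, Prod.snd_add, Prod.fst_sub, Prod.snd_sub, Prod.smul_fst, Prod.smul_snd,
      Pi.add_apply, Pi.sub_apply, Pi.smul_apply, smul_eq_mul]
    · linarith
    · linarith
    · linarith
    · rw [b2]; module
    · module
    · rw [b3]; module
  rw [hr, smul_oinner, oinner_smul, hu] at k0 k2
  -- The idempotents in question form a two-sheeted hyperboloid. The sign of `ξ₁ - ξ₃` selects the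
  -- sheet, and a boost of rapidity `∓ arsinh (2r)` reaches its vertex, `E₁` or `E₃`.
  have hq : (e.1 0 - e.1 2) ^ 2 = 1 + (2 * r) ^ 2 := by nlinarith
  obtain ⟨a, ha⟩ : ∃ a, a = e.1 0 - e.1 2 := ⟨_, rfl⟩
  rw [← ha] at he hq
  have hab : |a| = √(1 + (2 * r) ^ 2) := by rw [← hq, Real.sqrt_sq_eq_abs]
  rcases le_or_gt 0 a with h0 | h0
  · refine ⟨u, -(1 / 2) * Real.arsinh (2 * r), Or.inl ?_⟩
    rw [he, expGL_A2_apply hu]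
    have e1 : 2 * (-(1 / 2) * Real.arsinh (2 * r)) = -Real.arsinh (2 * r) := by ring
    rw [e1, Real.cosh_neg, Real.sinh_neg, Real.cosh_arsinh, Real.sinh_arsinh, ← hab,
      abs_of_nonneg h0]
    have e2 : a / 2 * a + r * -(2 * r) = 1 / 2 := by linarith
    have e3 : r * a + a / 2 * -(2 * r) = 0 := by ring
    rw [e2, e3]
    module
  · refine ⟨u, 1 / 2 * Real.arsinh (2 * r), Or.inr ?_⟩
    rw [he, expGL_A2_apply hu]
    have e1 : 2 * (1 / 2 * Real.arsinh (2 * r)) = Real.arsinh (2 * r) := by ring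
    rw [e1, Real.cosh_arsinh, Real.sinh_arsinh, ← hab, abs_of_neg h0]
    have e2 : a / 2 * -a + r * (2 * r) = -(1 / 2) := by linarith
    have e3 : r * -a + a / 2 * (2 * r) = 0 := by ring
    rw [e2, e3]
    module

theorem delta_F3_one (p : Octonion) : delta p (F3 (oe 0)) = (-2 : ℝ) • F3 p := by
  rw [delta_apply]
  apply J.ext' <;> simp only [F3, h1_fst_zero, h1_fst_one, h1_fst_two, h1_snd_zero, h1_snd_one, h1_snd_two, Prod.fst_add, Prod.snd_add, Prod.fst_sub, Prod.snd_sub, Prod.smul_fst, Prod.smul_snd,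
      Pi.add_apply, Pi.sub_apply, Pi.smul_apply, omul_zero, zero_omul, oconj_zero, oinner_zero, zero_oinner,
    omul_oe_zero, oe_zero_omul] <;> first | ring1 | module

theorem delta_F3_self {p : Octonion} (hp : p 0 = 0) (h1 : oinner p p = 1) :
    delta p (F3 p) = (2 : ℝ) • F3 (oe 0) := by
  have h := omul_oconj_add p p
  rw [oconj_eq_neg hp, h1, omul_neg] at h
  rw [delta_apply]
  apply J.ext' <;> simp only [F3, h1_fst_zero, h1_fst_one, h1_fst_two, h1_snd_zero, h1_snd_one, h1_snd_two, Prod.fst_add, Prod.snd_add, Prod.fst_sub, Prod.snd_sub, Prod.smul_fst, Prod.smul_snd,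
      Pi.add_apply, Pi.sub_apply, Pi.smul_apply, omul_zero, zero_omul, oconj_zero, oinner_zero, zero_oinner] <;>
    first | ring1 | module | linear_combination (norm := module) h

theorem expGL_delta_apply {p : Octonion} (hp : p 0 = 0) (h1 : oinner p p = 1) (a b t : ℝ) :
    (expGL (t • delta p) : EndJ) (a • F3 (oe 0) + b • F3 p) =
      (a * Real.cos (2 * t) + b * Real.sin (2 * t)) • F3 (oe 0) +
        (b * Real.cos (2 * t) - a * Real.sin (2 * t)) • F3 p := by
  have h2 : ∀ t, HasDerivAt (fun t : ℝ => 2 * t) 2 t := fun t => by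
    simpa using (hasDerivAt_id t).const_mul (2 : ℝ)
  have h := expGL_apply_of_hasDerivAt (delta p) (fun t =>
    (a * Real.cos (2 * t) + b * Real.sin (2 * t)) • F3 (oe 0) +
        (b * Real.cos (2 * t) - a * Real.sin (2 * t)) • F3 p) (fun t => by
      have hc := (h2 t).cos
      have hs := (h2 t).sin
      refine ((((hc.const_mul a).add (hs.const_mul b)).smul_const (F3 (oe 0))).add
        (((hc.const_mul b).sub (hs.const_mul a)).smul_const (F3 p))).congr_deriv ?_
      simp only [map_add, map_smul, delta_F3_one, delta_F3_self hp h1]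
      module) t
  simpa using h

theorem exists_rotation {x : Octonion} (hx : oinner x x = 1) :
    ∃ (p : Octonion) (t : ℝ), p 0 = 0 ∧ (expGL (t • delta p) : EndJ) (F3 x) = F3 (oe 0) := by
  obtain ⟨w, hw⟩ : ∃ w, w = x - x 0 • oe 0 := ⟨_, rfl⟩
  have hw0 : w 0 = 0 := by rw [hw]; simp [oe]
  have hn : x 0 ^ 2 + oinner w w = 1 := by
    have hxw : x = x 0 • oe 0 + w := by rw [hw]; abel
    rw [hxw, add_oinner, oinner_add, oinner_add, smul_oinner, oinner_smul, smul_oinner,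
      oinner_smul, oinner_oe, oe_oinner, oinner_oe, hw0] at hx
    simp [oe] at hx
    linarith
  -- Write `x = cos φ + (sin φ) p` with `p` a unit imaginary octonion, arbitrary if `x` is real. As
  -- `δ(p)` turns the plane of `F₃¹(1)`, `F₃¹(p)` at double speed, the time needed is `φ / 2`, `φ =
  -- arccos x₀`.
  obtain ⟨s, p, hs, hp0, hp, hr⟩ : ∃ (s : ℝ) (p : Octonion), 0 ≤ s ∧ p 0 = 0 ∧ oinner p p = 1 ∧
      w = s • p := by
    by_cases h0 : w = 0
    · refine ⟨0, oe 1, le_rfl, by simp [oe], ?_, by simpa using h0⟩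
      rw [oinner_oe]; simp [oe]
    · have hp : 0 < oinner w w :=
        lt_of_le_of_ne (oinner_self_nonneg _) fun h => h0 (oinner_self_eq_zero h.symm)
      have hs := Real.sqrt_pos.2 hp
      refine ⟨√(oinner w w), (√(oinner w w))⁻¹ • w, hs.le, by simp [hw0], ?_, ?_⟩
      · rw [smul_oinner, oinner_smul]
        field_simp
        exact (Real.sq_sqrt hp.le).symm
      · rw [smul_smul, mul_inv_cancel₀ hs.ne', one_smul]
  rw [hr, smul_oinner, oinner_smul, hp] at hn
  have hc : Real.cos (Real.arccos (x 0)) = x 0 := Real.cos_arccos (by nlinarith) (by nlinarith)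
  have hsn : Real.sin (Real.arccos (x 0)) = s := by
    rw [Real.sin_arccos, show 1 - x 0 ^ 2 = s ^ 2 by linarith, Real.sqrt_sq hs]
  refine ⟨p, 1 / 2 * Real.arccos (x 0), hp0, ?_⟩
  have hF : F3 x = x 0 • F3 (oe 0) + s • F3 p := by
    rw [← F3_smul, ← F3_smul, ← F3_add, ← hr, hw]; congr 1; abel
  rw [hF, expGL_delta_apply hp0 hp, show 2 * (1 / 2 * Real.arccos (x 0)) = Real.arccos (x 0) by ring,
    hc, hsn, show x 0 * x 0 + s * s = 1 by linarith, show s * x 0 - x 0 * s = 0 by ring]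
  module

theorem delta_E1 (p : Octonion) : delta p E1 = 0 := by
  rw [delta_apply]
  apply J.ext' <;> simp [E1, h1, omul_zero, zero_omul]

/-- A boost `b` makes `b g` fix `E₁`, the alternative `E₃` being excluded by signature. Then `b g`
preserves the space of the `F₃¹(x)` and its norm, so a rotation `c` brings the image of `F₃¹(1)`
back to `F₃¹(1)`. The product `c b g` lies in `M`, while `b` and `c` lie in `(K_ε)⁰`. -/
theorem stabE2_subset_Keps {g : GLJ} (hg : g ∈ stabE2) : g ∈ Keps := by
  have h12 : jordan E1 E2 = 0 := by
    rw [jordan_E1]; apply J.ext' <;> simp [E2, h1]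
  obtain ⟨u, t, hb⟩ := exists_boost (e := (g : EndJ) E1) (by rw [← hg.1, jordan_E1_E1])
    (by rw [tr_apply hg.1, tr_E1]) (by conv_lhs => rw [← hg.2, ← hg.1, h12, map_zero])
  obtain ⟨b, hbd⟩ : ∃ b, b = expGL (t • A2 u) := ⟨_, rfl⟩
  have hbK : b ∈ Keps0 := hbd ▸ Subgroup.subset_closure ⟨_, smul_A2_mem_keps t u, rfl⟩
  rw [← hbd] at hb
  have hbg : b * g ∈ stabE2 := stabE2.mul_mem (Keps0_le_stabE2 hbK) hg
  have hb1 : ((b * g : GLJ) : EndJ) E1 = E1 := hb.resolve_right (apply_E1_ne_E3 hbg)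
  have f1 := congrArg ((b * g : GLJ) : EndJ) (jordan_E1_F3 (oe 0))
  have f2 := congrArg ((b * g : GLJ) : EndJ) (jordan_E2_F3 (oe 0))
  rw [hbg.1, hb1, map_smul] at f1
  rw [hbg.1, hbg.2, map_smul] at f2
  have hF := eq_F3_of_half f1 f2
  obtain ⟨x, hx⟩ : ∃ x, ((b * g : GLJ) : EndJ) (F3 (oe 0)) = F3 x := ⟨_, hF⟩
  have hn := ip_apply hbg.1 (F3 (oe 0)) (F3 (oe 0))
  rw [hx, ip_F3_F3, ip_F3_F3, oinner_oe_zero_self] at hn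
  obtain ⟨p, s, hp, hr⟩ := exists_rotation (x := x) (by linarith)
  obtain ⟨c, hcd⟩ : ∃ c, c = expGL (s • delta p) := ⟨_, rfl⟩
  have hcK : c ∈ Keps0 := hcd ▸ Subgroup.subset_closure ⟨_, smul_delta_mem_keps s hp, rfl⟩
  rw [← hcd] at hr
  have hc1 : (c : EndJ) E1 = E1 := by
    rw [hcd]; exact expGL_apply_of_eq_zero (by rw [smul_apply, delta_E1, smul_zero])
  have hM : c * (b * g) ∈ M := by
    refine mem_M_of_fix (F4.mul_mem (Keps0_le_stabE2 hcK).1 hbg.1) ?_ ?_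
    · rw [Units.val_mul, mul_apply_eq_comp, hb1, hc1]
    · rw [Units.val_mul, mul_apply_eq_comp, hx, hr]
  refine Set.mem_mul.2 ⟨(c * b)⁻¹, Keps0.inv_mem (Keps0.mul_mem hcK hbK), _, hM, ?_⟩
  group

theorem Keps_eq_stabE2 : Keps = (stabE2 : Set GLJ) :=
  Set.Subset.antisymm (fun _ h => Keps_subset_stabE2 h) (fun _ h => stabE2_subset_Keps h)

/-! ### The factors of an element of `K_ε A N⁺` -/

theorem ip_Pminus_E2 : ip Pminus E2 = 1 := by rw [ip_E2]; rfl

theorem ip_Qplus_E2 (y : Octonion) : ip (Qplus y) E2 = 0 := by rw [ip_E2]; rfl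

theorem ip_F3_E2 (q : Octonion) : ip (F3 q) E2 = 0 := by rw [ip_E2]; rfl

theorem ip_apply_E2 {k : GLJ} (hk : k ∈ stabE2) (X : J) : ip ((k : EndJ) X) E2 = ip X E2 := by
  conv_lhs => rw [← hk.2, ip_apply hk.1]

theorem mem_Keps_A_Nplus {g : GLJ} : g ∈ Keps * A * Nplus ↔
    ∃ k ∈ stabE2, ∃ (t : ℝ) (x p : Octonion), p 0 = 0 ∧
      g = k * expGL (t • A3 (oe 0)) * expGL (G1 x + G2 p) := by
  rw [Keps_eq_stabE2]
  constructor
  · rintro ⟨_, ⟨k, hk, _, ⟨_, ⟨t, rfl⟩, rfl⟩, rfl⟩, _, ⟨X, hX, rfl⟩, rfl⟩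
    obtain ⟨x, p, hp, rfl⟩ := mem_nplus.1 hX
    exact ⟨k, hk, t, x, p, hp, rfl⟩
  · rintro ⟨k, hk, t, x, p, hp, rfl⟩
    exact Set.mul_mem_mul (Set.mul_mem_mul hk ⟨_, ⟨t, rfl⟩, rfl⟩)
      ⟨_, mem_nplus.2 ⟨x, p, hp, rfl⟩, rfl⟩

theorem mul_mem_F4 {k : GLJ} (hk : k ∈ stabE2) (t : ℝ) (x : Octonion) {p : Octonion}
    (hp : p 0 = 0) : k * expGL (t • A3 (oe 0)) * expGL (G1 x + G2 p) ∈ F4 :=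
  F4.mul_mem (F4.mul_mem hk.1 (expGL_A3_mem_F4 t)) (expGL_mem_F4_of_nplus x hp)

/-- `N⁺` fixes `P⁻`, `A` scales it by `e^{2t}`, and `k` does not affect the pairing with `E₂`. -/
theorem ip_mul_Pminus {k : GLJ} (hk : k ∈ stabE2) (t : ℝ) (x : Octonion) {p : Octonion}
    (hp : p 0 = 0) :
    ip (((k * expGL (t • A3 (oe 0)) * expGL (G1 x + G2 p) : GLJ) : EndJ) Pminus) E2 =
      Real.exp (t * 2) := by
  rw [Units.val_mul, Units.val_mul, mul_apply_eq_comp, mul_apply_eq_comp, expGL_nplus_Pminus x hp,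
    expGL_A3_apply A3_one_Pminus, ip_apply_E2 hk, smul_ip, ip_Pminus_E2, mul_one]

/-- Only the `P⁻`-component created by `N⁺` is seen by `E₂`, since `Q⁺(y)` itself has `ξ₂ = 0`. The
same applies to `ip_mul_F3`. -/
theorem ip_mul_Qplus {k : GLJ} (hk : k ∈ stabE2) (t : ℝ) (x : Octonion) {p : Octonion}
    (hp : p 0 = 0) (y : Octonion) :
    ip (((k * expGL (t • A3 (oe 0)) * expGL (G1 x + G2 p) : GLJ) : EndJ) (Qplus y)) E2 =
      2 * oinner x y * Real.exp (t * 2) := by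
  rw [Units.val_mul, Units.val_mul, mul_apply_eq_comp, mul_apply_eq_comp, expGL_nplus_Qplus x hp,
    map_add, map_smul, expGL_A3_apply A3_one_Pminus, expGL_A3_apply (A3_one_Qplus y),
    ip_apply_E2 hk, add_ip, smul_ip, smul_ip, smul_ip, ip_Pminus_E2, ip_Qplus_E2]
  ring

theorem ip_mul_F3 {k : GLJ} (hk : k ∈ stabE2) (t : ℝ) (x : Octonion) {p q : Octonion}
    (hp : p 0 = 0) (hq : q 0 = 0) :
    ip (((k * expGL (t • A3 (oe 0)) * expGL (G1 x + G2 p) : GLJ) : EndJ) (F3 q)) E2 =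
      -2 * oinner p q * Real.exp (t * 2) := by
  rw [Units.val_mul, Units.val_mul, mul_apply_eq_comp, mul_apply_eq_comp, expGL_nplus_F3 x hp hq]
  simp only [map_add, map_smul]
  rw [expGL_A3_apply A3_one_Pminus, expGL_A3_apply (A3_one_Qplus _),
    expGL_A3_apply (A3_one_F3 hq)]
  simp only [← map_add, ← map_smul]
  rw [ip_apply_E2 hk, add_ip, add_ip, smul_ip, smul_ip, smul_ip,
    smul_ip, ip_Pminus_E2, ip_Qplus_E2, ip_F3_E2]
  ring

/-- The argument of `𝒢₁` in the formula for `n_ε(g)`. -/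
def nepsOct (g : GLJ) : Octonion :=
  (ip ((g : EndJ) Pminus) E2)⁻¹ •
    ((1 / 2 : ℝ) • ∑ i : Fin 8, ip ((g : EndJ) (Qplus (oe i))) E2 • oe i)

/-- The argument of `𝒢₂` in the formula for `n_ε(g)`. -/
def nepsIm (g : GLJ) : Octonion :=
  (ip ((g : EndJ) Pminus) E2)⁻¹ •
    (-(1 / 2 : ℝ) • ∑ i : Fin 7, ip ((g : EndJ) (F3 (oe i.succ))) E2 • oe i.succ)

theorem oe_apply (i j : Fin 8) : oe i j = if j = i then 1 else 0 := Pi.single_apply _ _ _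

theorem oe_succ_zero (i : Fin 7) : oe i.succ 0 = 0 := by
  rw [oe_apply, if_neg (Fin.succ_ne_zero i).symm]

theorem nepsOct_apply (g : GLJ) (i : Fin 8) :
    nepsOct g i = (ip ((g : EndJ) Pminus) E2)⁻¹ * (1 / 2 * ip ((g : EndJ) (Qplus (oe i))) E2) := by
  simp [nepsOct, oe_apply, Finset.sum_apply]

theorem nepsIm_zero (g : GLJ) : nepsIm g 0 = 0 := by
  simp [nepsIm, oe_succ_zero, Finset.sum_apply]

theorem nepsIm_succ (g : GLJ) (i : Fin 7) : nepsIm g i.succ =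
    (ip ((g : EndJ) Pminus) E2)⁻¹ * (-(1 / 2) * ip ((g : EndJ) (F3 (oe i.succ))) E2) := by
  simp [nepsIm, oe_apply, Finset.sum_apply]

/-- Together with `nepsIm_mul` and `log_mul`, this recovers the parameters of a factorization from
the product alone, which yields uniqueness and the explicit formulas at once. -/
theorem nepsOct_mul {k : GLJ} (hk : k ∈ stabE2) (t : ℝ) (x : Octonion) {p : Octonion}
    (hp : p 0 = 0) : nepsOct (k * expGL (t • A3 (oe 0)) * expGL (G1 x + G2 p)) = x := by
  funext i
  rw [nepsOct_apply, ip_mul_Pminus hk t x hp, ip_mul_Qplus hk t x hp, oinner_oe]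
  have := Real.exp_ne_zero (t * 2)
  field_simp

theorem nepsIm_mul {k : GLJ} (hk : k ∈ stabE2) (t : ℝ) (x : Octonion) {p : Octonion}
    (hp : p 0 = 0) : nepsIm (k * expGL (t • A3 (oe 0)) * expGL (G1 x + G2 p)) = p := by
  funext i
  refine Fin.cases ?_ (fun i => ?_) i
  · rw [nepsIm_zero, hp]
  · rw [nepsIm_succ, ip_mul_Pminus hk t x hp, ip_mul_F3 hk t x hp (oe_succ_zero i), oinner_oe]
    have := Real.exp_ne_zero (t * 2)
    field_simp

theorem log_mul {k : GLJ} (hk : k ∈ stabE2) (t : ℝ) (x : Octonion) {p : Octonion}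
    (hp : p 0 = 0) : 1 / 2 * Real.log (ip (((k * expGL (t • A3 (oe 0)) *
      expGL (G1 x + G2 p) : GLJ) : EndJ) Pminus) E2) = t := by
  rw [ip_mul_Pminus hk t x hp, Real.log_exp]; ring

/-! ### Existence of the factorization -/

theorem G1_neg (x : Octonion) : G1 (-x) = -G1 x := by
  refine ContinuousLinearMap.ext fun X => ?_
  rw [neg_apply, G1_apply, G1_apply]
  apply J.ext' <;> simp only [h1_fst_zero, h1_fst_one, h1_fst_two, h1_snd_zero, h1_snd_one, h1_snd_two, Prod.fst_neg, Prod.snd_neg, Pi.neg_apply, omul_neg, neg_omul,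
    oconj_neg, oinner_neg, neg_oinner] <;> first | ring1 | module

theorem G2_neg (p : Octonion) : G2 (-p) = -G2 p := by
  refine ContinuousLinearMap.ext fun X => ?_
  rw [neg_apply, G2_apply, G2_apply]
  apply J.ext' <;> simp only [h1_fst_zero, h1_fst_one, h1_fst_two, h1_snd_zero, h1_snd_one, h1_snd_two, Prod.fst_neg, Prod.snd_neg, Pi.neg_apply, omul_neg, neg_omul,
    oconj_neg, oinner_neg, neg_oinner] <;> first | ring1 | module

theorem expGL_neg_smul (t : ℝ) (D : EndJ) : expGL (-t • D) = (expGL (t • D))⁻¹ := by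
  rw [← expGL_neg]
  exact congrArg expGL (neg_smul t D)

theorem inv_expGL_nplus (x p : Octonion) :
    (expGL (G1 x + G2 p))⁻¹ = expGL (G1 (-x) + G2 (-p)) := by
  rw [← expGL_neg, G1_neg, G2_neg, neg_add]

/-- No factorization is assumed here: linearity in `y` extends the definition of `nepsOct` from the
basis to all `y`. It shows that dividing by the candidate `n` cancels the pairing. -/
theorem ip_Qplus_eq {g : GLJ} (h : ip ((g : EndJ) Pminus) E2 ≠ 0) (y : Octonion) :
    ip ((g : EndJ) (Qplus y)) E2 = 2 * oinner (nepsOct g) y * ip ((g : EndJ) Pminus) E2 := by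
  have h1 := map_eq_sum_oe (xi2 ∘ₗ ((g : EndJ) : J →ₗ[ℝ] J) ∘ₗ QplusL) y
  have h2 : ∀ y, (xi2 ∘ₗ ((g : EndJ) : J →ₗ[ℝ] J) ∘ₗ QplusL) y = ip ((g : EndJ) (Qplus y)) E2 :=
    fun y => (ip_E2 _).symm
  simp only [h2] at h1
  rw [h1, oinner, Finset.mul_sum, Finset.sum_mul]
  refine Finset.sum_congr rfl fun i _ => ?_
  rw [nepsOct_apply]
  field_simp

theorem ip_F3_eq {g : GLJ} (h : ip ((g : EndJ) Pminus) E2 ≠ 0) {q : Octonion} (hq : q 0 = 0) :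
    ip ((g : EndJ) (F3 q)) E2 = -2 * oinner (nepsIm g) q * ip ((g : EndJ) Pminus) E2 := by
  have h1 := map_eq_sum_oe (xi2 ∘ₗ ((g : EndJ) : J →ₗ[ℝ] J) ∘ₗ F3L) q
  have h2 : ∀ y, (xi2 ∘ₗ ((g : EndJ) : J →ₗ[ℝ] J) ∘ₗ F3L) y = ip ((g : EndJ) (F3 y)) E2 :=
    fun y => (ip_E2 _).symm
  simp only [h2] at h1
  rw [h1, Fin.sum_univ_succ, oinner, Fin.sum_univ_succ (fun i => nepsIm g i * q i), hq, zero_mul, mul_zero,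
    zero_add, zero_add, Finset.mul_sum, Finset.sum_mul]
  refine Finset.sum_congr rfl fun i _ => ?_
  rw [nepsIm_succ]
  field_simp

theorem sub_oinner (x y z : Octonion) : oinner (x - y) z = oinner x z - oinner y z := by
  rw [sub_eq_add_neg, add_oinner, neg_oinner, ← sub_eq_add_neg]

/-- The idempotents of trace `1` orthogonal to all `Q⁺(y)` and all `F₃¹(q)`, `q` imaginary. -/
theorem eq_E2_or_eq_E1 {Y : J} (h1 : jordan Y Y = Y) (h2 : tr Y = 1)
    (hP : ip Y Pminus ^ 2 = 1) (hQ : ∀ y, ip Y (Qplus y) = 0)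
    (hF : ∀ q : Octonion, q 0 = 0 → ip Y (F3 q) = 0) : Y = E2 ∨ Y = E1 := by
  have hx2 : Y.2 1 = oconj (Y.2 0) := by
    -- The pairing with `Q⁺(y)` is `2 (x₁ - x̄₂ | y)`, so this choice of `y` gives a norm.
    have h := hQ (Y.2 0 - oconj (Y.2 1))
    rw [ip_eq] at h
    simp only [Qplus, h1_fst_zero, h1_fst_one, h1_fst_two, h1_snd_zero, h1_snd_one, h1_snd_two, oinner_zero] at h
    rw [← oinner_oconj_oconj (Y.2 1), oconj_oconj] at h
    have h' : oinner (Y.2 0 - oconj (Y.2 1)) (Y.2 0 - oconj (Y.2 1)) = 0 := by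
      rw [sub_oinner]
      linarith
    rw [sub_eq_zero.1 (oinner_self_eq_zero h'), oconj_oconj]
  obtain ⟨s, hs⟩ : ∃ s : ℝ, Y.2 2 = s • oe 0 := by
    refine ⟨Y.2 2 0, sub_eq_zero.1 (oinner_self_eq_zero ?_)⟩
    have h0 : (Y.2 2 - Y.2 2 0 • oe 0) 0 = 0 := by simp [oe]
    have h := hF _ h0
    rw [ip_eq] at h
    simp only [F3, h1_fst_zero, h1_fst_one, h1_fst_two, h1_snd_zero, h1_snd_one, h1_snd_two, oinner_zero] at h
    rw [sub_oinner, smul_oinner, oe_oinner, h0]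
    linarith
  have k0 := congrArg (fun X : J => X.1 0) h1
  have k1 := congrArg (fun X : J => X.1 1) h1
  have k2 := congrArg (fun X : J => X.1 2) h1
  have k3 := congrArg (fun X : J => X.2 0) h1
  have k4 := congrArg (fun X : J => oconj (X.2 1)) h1
  have k5 := congrArg (fun X : J => X.2 2 0) h1
  rw [ip_eq] at hP
  rw [tr_eq] at h2
  simp only [jordan, h1_fst_zero, h1_fst_one, h1_fst_two, h1_snd_zero, h1_snd_one, h1_snd_two, hx2, hs, oinner_oconj_oconj, oconj_oconj, oconj_smul, oconj_omul,
    smul_omul, omul_smul, oconj_oe_zero, omul_oe_zero, oe_zero_omul, smul_oinner, oinner_smul,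
    oinner_oe_zero_self, Pminus, oinner_zero, oconj_add] at k0 k1 k2 k3 k4 k5 hP
  obtain ⟨x, hx⟩ : ∃ x, x = Y.2 0 := ⟨_, rfl⟩
  obtain ⟨N, hN⟩ : ∃ N, N = oinner x x := ⟨_, rfl⟩
  have hxx : (x ⋆ oconj x) 0 = N := by
    have := congrFun (omul_oconj_add x x) 0
    simp [oe] at this
    rw [hN]; linarith
  simp only [← hx, ← hN, hxx, Pi.smul_apply, Pi.add_apply, smul_eq_mul, oe_zero_eq,
    Matrix.cons_val] at k0 k1 k2 k3 k4 k5 hP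
  -- Since `x₁` and `x₂` have equal norms, the `ξ₃` slot of `Y² = Y` reduces to `ξ₃² = ξ₃`.
  have h3 : Y.1 2 * (Y.1 2 - 1) = 0 := by linarith
  rcases mul_eq_zero.1 h3 with h3 | h3
  -- For `ξ₃ = 0`, the `x₁` and `x₂` slots read `(ξ₂ - s)x = x` and `(ξ₁ + s)x = x`; adding them
  -- with `ξ₁ + ξ₂ = 1` gives `x = 2x`.
  · have hx0 : x = 0 := by
      have e : Y.1 0 = 1 - Y.1 1 := by linarith
      rw [h3, e] at k4
      rw [h3] at k3
      linear_combination (norm := module) -k3 - k4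
    have hN0 : N = 0 := by rw [hN, hx0, oinner_zero]
    -- Here `(Y|P⁻) = 2(ξ₂ - s) - 1`, which is `±1`; the two values lead to `E₁` and `E₂`.
    have hd : (Y.1 1 - s) * (Y.1 1 - s - 1) = 0 := by
      have e : Y.1 0 = 1 - Y.1 1 := by linarith
      rw [e] at hP; nlinarith
    have hYs : Y.2 0 = 0 := hx.symm.trans hx0
    have hY1 : Y.2 1 = 0 := by rw [hx2, hYs, oconj_zero]
    rcases mul_eq_zero.1 hd with hd | hd
    · right
      have e1 : Y.1 1 = 0 := by
        have : Y.1 1 = s := by linarith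
        rw [this] at k1 ⊢; linarith
      have e2 : s = 0 := by linarith
      refine J.ext' ?_ e1 h3 hYs hY1 (by rw [hs, e2, zero_smul]; rfl)
      change Y.1 0 = 1; linarith
    · left
      have e2 : s = 0 := by
        have : Y.1 1 = s + 1 := by linarith
        rw [this] at k1; linarith
      refine J.ext' ?_ ?_ h3 hYs hY1 (by rw [hs, e2, zero_smul]; rfl)
      · change Y.1 0 = 0; linarith
      · change Y.1 1 = 1; linarith
  -- For `ξ₃ = 1`, the idempotent equations give `N = s = ξ₂ = -ξ₁`, hence `(Y|P⁻) = 0`.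
  · exfalso
    have e : Y.1 0 = -Y.1 1 := by linarith
    have e3 : Y.1 2 = 1 := by linarith
    rw [e] at k0 k5 hP
    have hNs : N = s := by linarith
    have hs1 : s = Y.1 1 := by linarith
    rw [hs1] at hP
    ring_nf at hP
    norm_num at hP

/-- The Peirce `½`-space of `E₂` contains `F₁¹(1)`, of positive square, whereas on that of `E₁`,
made of `F₂¹` and `F₃¹`, the form is negative definite. -/
theorem apply_E2_ne_E1 {g : GLJ} (hg : g ∈ F4) : (g : EndJ) E2 ≠ E1 := fun h => by
  have h1 : jordan E2 (F1 (oe 0)) = (1 / 2 : ℝ) • F1 (oe 0) := by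
    rw [jordan_E2]; apply J.ext' <;> simp [F1, F4Iwasawa.h1]
  have h2 := congrArg (g : EndJ) h1
  rw [hg, h, map_smul, jordan_E1] at h2
  have h3 := ip_apply hg (F1 (oe 0)) (F1 (oe 0))
  rw [ip_F1_F1, oinner_oe_zero_self] at h3
  obtain ⟨Y, hY⟩ : ∃ Y, Y = (g : EndJ) (F1 (oe 0)) := ⟨_, rfl⟩
  rw [← hY] at h2 h3
  have a0 := congrArg (fun X : J => X.1 0) h2
  have a1 := congrArg (fun X : J => X.1 1) h2
  have a2 := congrArg (fun X : J => X.1 2) h2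
  have a3 := congrArg (fun X : J => X.2 0) h2
  simp only [h1_fst_zero, h1_fst_one, h1_fst_two, h1_snd_zero, h1_snd_one, h1_snd_two, Prod.fst_add, Prod.snd_add, Prod.fst_sub, Prod.snd_sub, Prod.smul_fst, Prod.smul_snd,
      Pi.add_apply, Pi.sub_apply, Pi.smul_apply, smul_eq_mul] at a0 a1 a2 a3
  have b0 : Y.1 0 = 0 := by linarith
  have b1 : Y.1 1 = 0 := by linarith
  have b2 : Y.1 2 = 0 := by linarith
  have b3 : Y.2 0 = 0 := by linear_combination (norm := module) (-2 : ℝ) • a3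
  rw [ip_eq, b0, b1, b2, b3, oinner_zero] at h3
  have := oinner_self_nonneg (Y.2 1)
  have := oinner_self_nonneg (Y.2 2)
  linarith

theorem exists_factorization {g : GLJ} (hg : g ∈ F4) (hc : ip ((g : EndJ) Pminus) E2 ≠ 0) :
    ∃ k ∈ stabE2, ∃ (t : ℝ) (x p : Octonion), p 0 = 0 ∧
      g = k * expGL (t • A3 (oe 0)) * expGL (G1 x + G2 p) := by
  obtain ⟨c, hcd⟩ : ∃ c, c = ip ((g : EndJ) Pminus) E2 := ⟨_, rfl⟩
  obtain ⟨x, hx⟩ : ∃ x, x = nepsOct g := ⟨_, rfl⟩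
  obtain ⟨p, hpd⟩ : ∃ p, p = nepsIm g := ⟨_, rfl⟩
  have hp : p 0 = 0 := by rw [hpd, nepsIm_zero]
  have hp' : (-p) 0 = 0 := by simp [hp]
  -- The sign of `c` is not yet known, hence the absolute value; accordingly only `(Y|P⁻)² = 1` is
  -- passed on. Positivity follows once the factorization exists.
  obtain ⟨t, ht⟩ : ∃ t, t = 1 / 2 * Real.log |c| := ⟨_, rfl⟩
  have hn := expGL_mem_F4_of_nplus x hp
  have ha := expGL_A3_mem_F4 t
  obtain ⟨h, hh⟩ : ∃ h, h = g * (expGL (G1 x + G2 p))⁻¹ * (expGL (t • A3 (oe 0)))⁻¹ := ⟨_, rfl⟩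
  have hF : h ∈ F4 := hh ▸ F4.mul_mem (F4.mul_mem hg (F4.inv_mem hn)) (F4.inv_mem ha)
  refine ⟨h, ⟨hF, ?_⟩, t, x, p, hp, by rw [hh]; group⟩
  have happ : ∀ (X : J) (d : ℝ), A3 (oe 0) X = d • X → ip ((h : EndJ) X) E2 =
      Real.exp (-t * d) * ip ((g : EndJ) ((expGL (G1 (-x) + G2 (-p)) : EndJ) X)) E2 := by
    intro X d hX
    rw [hh, inv_expGL_nplus, ← expGL_neg_smul, Units.val_mul, Units.val_mul,
      mul_apply_eq_comp, mul_apply_eq_comp, expGL_A3_apply hX, map_smul, map_smul, smul_ip]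
  have hinv := F4.inv_mem hF
  have hYX : ∀ X, ip (((h⁻¹ : GLJ) : EndJ) E2) X = ip ((h : EndJ) X) E2 := fun X => by
    rw [ip_inv_apply hF, ip_comm]
  -- Pairings with `h⁻¹E₂` are `E₂`-coefficients of `hX`; `x` and `p` were chosen to make those of
  -- `Q⁺(y)` and imaginary `F₃¹(q)` vanish.
  have key := eq_E2_or_eq_E1 (Y := ((h⁻¹ : GLJ) : EndJ) E2) (by rw [← hinv, jordan_E2_E2])
    (by rw [tr_apply hinv, tr_E2]) ?_ (fun y => ?_) (fun q hq => ?_)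
  · have hE := key.resolve_right (apply_E2_ne_E1 hinv)
    conv_lhs => rw [← hE]
    exact units_apply_inv h E2
  · rw [hYX, happ _ _ A3_one_Pminus, expGL_nplus_Pminus _ hp', ← hcd, ht,
      show -(1 / 2 * Real.log |c|) * 2 = -Real.log |c| by ring, Real.exp_neg,
      Real.exp_log (abs_pos.2 (hcd ▸ hc)), mul_pow, inv_pow, sq_abs]
    exact inv_mul_cancel₀ (pow_ne_zero 2 (hcd ▸ hc))
  · rw [hYX, happ _ _ (A3_one_Qplus y), expGL_nplus_Qplus _ hp', map_add, map_smul, add_ip,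
      smul_ip, ip_Qplus_eq hc, ← hx, neg_oinner]
    ring
  · have h0 : oinner x (q ⋆ x) = 0 := by
      have := oinner_omul_left hq x x
      rw [oinner_comm] at this
      linarith
    rw [hYX, happ _ _ (A3_one_F3 hq), expGL_nplus_F3 _ hp' hq, map_add, map_add, map_smul, add_ip,
      add_ip, smul_ip, ip_Qplus_eq hc, ip_F3_eq hc hq, ← hx, ← hpd, neg_oinner, omul_neg, neg_neg,
      h0]
    ring

theorem Keps_A_Nplus_eq_ne_zero :
    Keps * A * Nplus = {g : GLJ | g ∈ F4 ∧ ip ((g : EndJ) Pminus) E2 ≠ 0} := by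
  ext g
  rw [mem_Keps_A_Nplus]
  constructor
  · rintro ⟨k, hk, t, x, p, hp, rfl⟩
    exact ⟨mul_mem_F4 hk t x hp, by rw [ip_mul_Pminus hk t x hp]; exact Real.exp_ne_zero _⟩
  · exact fun h => exists_factorization h.1 h.2

theorem Keps_A_Nplus_eq_pos :
    Keps * A * Nplus = {g : GLJ | g ∈ F4 ∧ 0 < ip ((g : EndJ) Pminus) E2} := by
  refine Set.Subset.antisymm (fun g h => ?_) fun g h => ?_
  · obtain ⟨k, hk, t, x, p, hp, rfl⟩ := mem_Keps_A_Nplus.1 h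
    exact ⟨mul_mem_F4 hk t x hp, by rw [ip_mul_Pminus hk t x hp]; exact Real.exp_pos _⟩
  · rw [Keps_A_Nplus_eq_ne_zero]
    exact ⟨h.1, h.2.ne'⟩

/-! ### Openness and density -/

theorem isOpen_Keps_A_Nplus : IsOpen {g : F4 | (g : GLJ) ∈ Keps * A * Nplus} := by
  have h : {g : F4 | (g : GLJ) ∈ Keps * A * Nplus} =
      {g : F4 | ((((g : GLJ) : EndJ) Pminus).1 1) ≠ 0} := by
    ext g
    rw [Keps_A_Nplus_eq_ne_zero]
    simp [ip_E2]
  rw [h]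
  refine isOpen_ne_fun ?_ continuous_const
  have hc : Continuous fun g : F4 => ((g : GLJ) : EndJ) :=
    Units.continuous_val.comp continuous_subtype_val
  have h1 : Continuous fun g : F4 => ((g : GLJ) : EndJ) Pminus := hc.clm_apply continuous_const
  exact (continuous_apply 1).comp (continuous_fst.comp h1)

theorem continuous_expGL_smul (D : EndJ) : Continuous fun t : ℝ => expGL (t • D) := by
  have h : ∀ D : EndJ, Continuous fun t : ℝ => (expGL (t • D) : EndJ) := fun D =>
    continuous_iff_continuousAt.2 fun t => (hasDerivAt_expGL D t).continuousAt
  refine Units.continuous_iff.2 ⟨h D, ?_⟩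
  have h2 : (fun t : ℝ => ((expGL (t • D))⁻¹ : GLJ).val) = fun t : ℝ => (expGL (t • -D) : EndJ) :=
    funext fun t => by rw [smul_neg, expGL_neg]
  rw [h2]
  exact h (-D)

theorem A1_one_E2 : A1 (oe 0) E2 = -F1 (oe 0) := by
  rw [A1_apply]
  apply J.ext' <;> simp [E2, F1, h1, omul_zero, zero_omul, oconj_zero, oinner_zero]

theorem A1_one_E3 : A1 (oe 0) E3 = F1 (oe 0) := by
  rw [A1_apply]
  apply J.ext' <;> simp [E3, F1, h1, omul_zero, zero_omul, oconj_zero, oinner_zero]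

theorem A1_one_F1 : A1 (oe 0) (F1 (oe 0)) = (2 : ℝ) • (E2 - E3) := by
  rw [A1_apply]
  apply J.ext' <;> simp only [F1, h1_fst_zero, h1_fst_one, h1_fst_two, h1_snd_zero, h1_snd_one, h1_snd_two, oinner_oe_zero_self, E2, E3, omul_zero, zero_omul, oconj_zero, oinner_zero, zero_oinner, Prod.fst_add, Prod.snd_add, Prod.fst_sub, Prod.snd_sub, Prod.smul_fst, Prod.smul_snd,
      Pi.add_apply, Pi.sub_apply, Pi.smul_apply, smul_eq_mul] <;>
    first | ring1 | module

theorem expGL_A1_one_E2 (t : ℝ) : (expGL (t • A1 (oe 0)) : EndJ) E2 =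
    (1 / 2 : ℝ) • (E2 + E3) + (1 / 2 * Real.cos (2 * t)) • (E2 - E3) -
      (1 / 2 * Real.sin (2 * t)) • F1 (oe 0) := by
  have h2 : ∀ t, HasDerivAt (fun t : ℝ => 2 * t) 2 t := fun t => by
    simpa using (hasDerivAt_id t).const_mul (2 : ℝ)
  have h := expGL_apply_of_hasDerivAt (A1 (oe 0)) (fun t =>
    (1 / 2 : ℝ) • (E2 + E3) + (1 / 2 * Real.cos (2 * t)) • (E2 - E3) -
      (1 / 2 * Real.sin (2 * t)) • F1 (oe 0)) (fun t => by
      refine (((((h2 t).cos.const_mul (1 / 2)).smul_const (E2 - E3)).const_add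
        ((1 / 2 : ℝ) • (E2 + E3))).sub
        (((h2 t).sin.const_mul (1 / 2)).smul_const (F1 (oe 0)))).congr_deriv ?_
      simp only [map_add, map_sub, map_smul, A1_one_E2, A1_one_E3, A1_one_F1]
      module) t
  rw [← h]
  congr 1
  simp only [mul_zero, Real.cos_zero, Real.sin_zero]
  module

/-- A nilpotent element with `ξ₂ = 0` has `x₁ = 0` and `ξ₃ ≠ 0`. -/
theorem nilpotent_apply {v : J} (h0 : v ≠ 0) (h1 : jordan v v = 0) (h2 : tr v = 0)
    (h3 : v.1 1 = 0) : v.2 0 = 0 ∧ v.1 2 ≠ 0 := by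
  have k0 := congrArg (fun X : J => X.1 0) h1
  have k1 := congrArg (fun X : J => X.1 1) h1
  have k2 := congrArg (fun X : J => X.1 2) h1
  simp only [jordan, h1_fst_zero, h1_fst_one, h1_fst_two, h1_snd_zero, h1_snd_one, h1_snd_two, h3, Prod.fst_zero, Pi.zero_apply] at k0 k1 k2
  rw [tr_eq, h3] at h2
  have e : v.1 0 = -v.1 2 := by linarith
  rw [e] at k0
  have n0 := oinner_self_nonneg (v.2 0)
  have n2 := oinner_self_nonneg (v.2 2)
  -- As `ξ₁ = -ξ₃`, subtracting the `ξ₁` slot of `v² = 0` from the `ξ₃` slot leaves `(x₁|x₁) +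
  -- (x₃|x₃) = 0`.
  have hx0 : v.2 0 = 0 := oinner_self_eq_zero (by linarith)
  have hx2 : v.2 2 = 0 := oinner_self_eq_zero (by linarith)
  refine ⟨hx0, fun h => h0 ?_⟩
  rw [h, hx0, oinner_zero] at k2
  exact J.ext' (by simp [e, h]) h3 h hx0 (oinner_self_eq_zero (by linarith)) hx2

theorem jordan_Pminus_Pminus : jordan Pminus Pminus = 0 := by
  apply J.ext' <;> simp only [jordan, Pminus, h1_fst_zero, h1_fst_one, h1_fst_two, h1_snd_zero, h1_snd_one, h1_snd_two, omul_zero, zero_omul, oconj_zero, oinner_zero, zero_oinner, oinner_oe_zero_self, Prod.fst_zero,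
    Prod.snd_zero, Pi.zero_apply] <;> first | ring1 | module

/-- If `v = gP⁻` has `ξ₂ = 0`, then `v² = 0` forces `x₁ = 0` and `ξ₃ ≠ 0`. Rotating by `exp(t
Ã₁¹(1))` produces the `E₂`-coefficient `ξ₃ sin² t`, nonzero for `0 < t < π`, and `t → 0⁺` gives the
approximation of `g`. -/
theorem dense_Keps_A_Nplus : Dense {g : F4 | (g : GLJ) ∈ Keps * A * Nplus} := by
  intro g
  by_cases hg : ip (((g : GLJ) : EndJ) Pminus) E2 = 0
  swap
  · refine subset_closure ?_
    rw [Set.mem_ofPred_eq, Keps_A_Nplus_eq_ne_zero]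
    exact ⟨g.2, hg⟩
  obtain ⟨v, hv⟩ : ∃ v, v = ((g : GLJ) : EndJ) Pminus := ⟨_, rfl⟩
  rw [← hv, ip_E2] at hg
  obtain ⟨hx, h3⟩ := nilpotent_apply (v := v)
    (fun h0 => by
      have h1 := units_inv_apply (g : GLJ) Pminus
      rw [← hv, h0, map_zero] at h1
      have h2 := congrArg (fun X : J => X.1 1) h1
      simp [Pminus, F4Iwasawa.h1] at h2)
    (by rw [hv, ← g.2, jordan_Pminus_Pminus, map_zero])
    (by rw [hv, tr_apply g.2, tr_eq]; simp [Pminus, h1]) hg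
  have hm : ∀ t : ℝ, expGL (t • A1 (oe 0)) ∈ F4 := fun t => ((isDer_A1 _).smul t).expGL_mem
  let γ : ℝ → F4 := fun t => ⟨expGL (t • A1 (oe 0)), hm t⟩ * g
  have hγ : Continuous γ :=
    ((continuous_expGL_smul (A1 (oe 0))).subtype_mk hm).mul continuous_const
  have h0 : γ 0 = g := by
    refine Subtype.ext ?_
    simp [γ, expGL_zero]
  have ht : Filter.Tendsto γ (nhdsWithin 0 (Set.Ioi 0)) (nhds g) := by
    have := (hγ.tendsto 0).mono_left (nhdsWithin_le_nhds (s := Set.Ioi 0))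
    rwa [h0] at this
  refine mem_closure_of_tendsto ht ?_
  filter_upwards [Ioo_mem_nhdsGT Real.pi_pos] with t htt
  rw [Keps_A_Nplus_eq_ne_zero]
  refine ⟨(γ t).2, ?_⟩
  have hval : (((γ t : F4) : GLJ) : EndJ) Pminus = (expGL (t • A1 (oe 0)) : EndJ) v := by
    rw [hv]; rfl
  -- By invariance of the form the rotation is moved onto `E₂`, where its action is explicit.
  have h4 := ip_inv_apply (hm (-t)) v E2
  rw [expGL_A1_one_E2, expGL_neg_smul, inv_inv] at h4
  rw [hval, h4, ip_eq]
  simp only [E2, E3, F1, h1_fst_zero, h1_fst_one, h1_fst_two, h1_snd_zero, h1_snd_one, h1_snd_two, Prod.fst_add, Prod.snd_add, Prod.fst_sub, Prod.snd_sub, Prod.smul_fst, Prod.smul_snd,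
      Pi.add_apply, Pi.sub_apply, Pi.smul_apply, hx, hg, omul_zero, zero_omul, oconj_zero, oinner_zero, zero_oinner, smul_eq_mul, mul_neg, Real.cos_neg,
    Real.cos_two_mul', Real.cos_sq']
  have hs := (Real.sin_pos_of_mem_Ioo htt).ne'
  have : v.1 2 * Real.sin t ^ 2 ≠ 0 := mul_ne_zero h3 (pow_ne_zero 2 hs)
  intro h
  apply this
  rw [← h]
  simp only [omul_zero, oinner_zero, zero_smul, sub_zero, add_zero, smul_zero]
  ring

end F4Iwasawa

end

theorem theorem9p6 :
    -- `K_ε` is the stabilizer of `E₂`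
    Keps = {g : GLJ | g ∈ F4 ∧ (g : EndJ) E2 = E2} ∧
    -- the set `K_ε A N⁺`
    Keps * A * Nplus = {g : GLJ | g ∈ F4 ∧ ip ((g : EndJ) Pminus) E2 ≠ 0} ∧
    Keps * A * Nplus = {g : GLJ | g ∈ F4 ∧ 0 < ip ((g : EndJ) Pminus) E2} ∧
    -- it is open and dense in `F₄₍₋₂₀₎`
    IsOpen {g : F4 | (g : GLJ) ∈ Keps * A * Nplus} ∧
    Dense {g : F4 | (g : GLJ) ∈ Keps * A * Nplus} ∧
    -- existence, uniqueness and explicit form of the factors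
    ∀ g ∈ Keps * A * Nplus,
      ∃ k ∈ Keps, ∃ H ∈ 𝔞, ∃ n ∈ Nplus,
        g = k * expGL H * n ∧
        (∀ k' ∈ Keps, ∀ H' ∈ 𝔞, ∀ n' ∈ Nplus, g = k' * expGL H' * n' →
          k' = k ∧ H' = H ∧ n' = n) ∧
        H = ((1 / 2 : ℝ) * Real.log (ip ((g : EndJ) Pminus) E2)) • A3 (oe 0) ∧
        n = expGL
          (G1 ((ip ((g : EndJ) Pminus) E2)⁻¹ •
              ((1 / 2 : ℝ) • ∑ i : Fin 8, ip ((g : EndJ) (Qplus (oe i))) E2 • oe i))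
            + G2 ((ip ((g : EndJ) Pminus) E2)⁻¹ •
              (-(1 / 2 : ℝ) • ∑ i : Fin 7,
                ip ((g : EndJ) (F3 (oe i.succ))) E2 • oe i.succ))) ∧
        k = g * n⁻¹ * expGL (-H) := by
  refine ⟨Keps_eq_stabE2, Keps_A_Nplus_eq_ne_zero, Keps_A_Nplus_eq_pos, isOpen_Keps_A_Nplus,
    dense_Keps_A_Nplus, fun g hg => ?_⟩
  obtain ⟨k, hk, t, x, p, hp, rfl⟩ := mem_Keps_A_Nplus.1 hg
  refine ⟨k, Keps_eq_stabE2 ▸ hk, t • A3 (oe 0), ⟨t, rfl⟩, expGL (G1 x + G2 p),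
    ⟨_, mem_nplus.2 ⟨x, p, hp, rfl⟩, rfl⟩, rfl, ?_, ?_, ?_, ?_⟩
  · rintro k' hk' _ ⟨t', rfl⟩ _ ⟨X, hX, rfl⟩ h
    obtain ⟨x', p', hp', rfl⟩ := mem_nplus.1 hX
    rw [Keps_eq_stabE2] at hk'
    -- Each of `t`, `x`, `p` is a function of the product alone, so two factorizations share them;
    -- cancelling then identifies the `K_ε` factors.
    have ht : t = t' := by rw [← log_mul hk t x hp, h, log_mul hk' t' x' hp']
    have hx : x = x' := by rw [← nepsOct_mul hk t x hp, h, nepsOct_mul hk' t' x' hp']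
    have hpp : p = p' := by rw [← nepsIm_mul hk t x hp, h, nepsIm_mul hk' t' x' hp']
    subst ht hx hpp
    exact ⟨(mul_right_cancel (mul_right_cancel h)).symm, rfl, rfl⟩
  · rw [log_mul hk t x hp]
  · exact congrArg₂ (fun a b => expGL (G1 a + G2 b)) (nepsOct_mul hk t x hp).symm
      (nepsIm_mul hk t x hp).symm
  · rw [expGL_neg]; group
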